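/- **Setting.** Let $A=\{1,\dots,K\}$ with $K\ge 2$. A family of transition probabilities is a family of numbers $p(a\mid x_{-\infty}^{-1})\in[0,1]$, $a\in A$, $x_{-\infty}^{-1}\in A_{-\infty}^{-1}$, measurable in $x_{-\infty}^{-1}$ and with $\sum_a p(a\mid x_{-\infty}^{-1})=1$. It is non-null if $\inf p>0$; with $$\beta_k=\sup\{|p(a\mid x_{-\infty}^{-1})-p(a\mid y_{-\infty}^{-1})| : a\in A,\ x_{-k}^{-1}=y_{-k}^{-1}\}$$ it is continuous if $\beta_k\to0$. Let $p$ be non-null and continuous, and let $\mathbb P$ be a probability measure on $A^{\mathbb Z}$ that is stationary and ergodic for the shift $(\mathscr S z)_i=z_{i-1}$ and invariant with respect to $p$, i.e. $\int f(z_{-\infty}^0)\,d\mathbb P=\int\sum_{a}p(a\mid z_{-\infty}^{-1})f(z_{-\infty}^{-1}a)\,d\mathbb P$ for every continuous $f:A_{-\infty}^0\to\mathbb R$. Order $A_{-\infty}^0$ lexicographically, comparing the symbols closest to position $0$ first, and put $h(x)=\mathbb P\{z: z_{-\infty}^0\le x\}$ and $\Omega=[0,1]$. Let $\mathscr Q\subset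 A_{-\infty}^0$ be the set of all sequences $K_{-\infty}^{-(k+2)}\,a\,z_{-k}^0$ and $1_{-\infty}^{-(k+2)}\,(a+1)\,z_{-k}^0$ with $k\ge-1$, $1\le a\le K-1$ and $z_{-k}^0$ a word of length $k+1$ (empty if $k=-1$); here $K_{-\infty}^{m}$ and $1_{-\infty}^{m}$ are constant sequences. Then every $\omega\in\Omega\setminus h(\mathscr Q)$ has exactly one preimage $h^{-1}(\omega)$; on $\Omega\setminus h(\mathscr Q)$ put $T=h\circ\mathscr S\circ h^{-1}$, where $\mathscr S$ acts on $A_{-\infty}^0$ by $(\mathscr S x)_i=x_{i-1}$. **Theorem.** 1. Put $\eta_0=0$, $\eta_K=1$ and $\eta_k=h(K_{-\infty}^{-1}k)$ for $1\le k\le K-1$. Then $\eta_k=h(1_{-\infty}^{-1}(k+1))$ for $1\le k\le K-1$, and $\eta_0<\eta_1<\dots<\eta_K$. The map $T$ extends to a map $T:\Omega\to\Omega$ that is continuous and increasing on each interval $I_j=\,]\eta_{j-1},\eta_j[$, $1\le j\le K$. 2. The extended map is topological Markov: the closure of each $T(I_i)$ is a union of closures of intervals $I_j$. Lebesgue measure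 $\lambda$ on $\Omega$ is invariant and ergodic for $T$. Let $W_n(\omega)=j$ if $T^n(\omega)\in I_j$ (this defines all $W_n$ for $\lambda$-a.e. $\omega$). The conditional probabilities of the dynamical partitions are given by $p$: for every $a\in A$, $$\lambda(W_0=a\mid W_1,W_2,\dots)=p(a\mid \cdots W_2W_1)\quad\lambda\text{-a.e.},$$ and for every $x_{-\infty}^0\in A_{-\infty}^0$, $$\lim_{k\to\infty}\frac{\lambda\{W_0=x_0,W_1=x_{-1},\dots,W_k=x_{-k}\}}{\lambda\{W_0=x_{-1},\dots,W_{k-1}=x_{-k}\}}=p(x_0\mid x_{-\infty}^{-1}).$$ 3. $T$ is differentiable at every $\omega\in\Omega\setminus h(\mathscr Q)$ (one-sidedly at $\omega=0,1$), with $T'(\omega)=1/p\big(h^{-1}(\omega)_0\mid h^{-1}(\omega)_{-\infty}^{-1}\big)$. 4. Let $k\ge-1$, $1\le a\le K-1$, let $z_{-k}^0$ be a word of length $k+1$, and put $x=K_{-\infty}^{-(k+2)}\,a\,z_{-k}^0$ and $y=1_{-\infty}^{-(k+2)}\,(a+1)\,z_{-k}^0$. Then $h(x)=h(y)=:\omega$,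 and the left and right derivatives of $T$ at $\omega$ exist and equal $1/p(x_0\mid x_{-\infty}^{-1})$ and $1/p(y_0\mid y_{-\infty}^{-1})$, respectively. (If $k=-1$, then $\omega=\eta_a$, and these are the one-sided derivatives of the continuous extensions of $T|_{I_a}$ and $T|_{I_{a+1}}$ to $\eta_a$.) 5. Suppose that for all $1\le a\le K-1$, $k\ge0$ and $z_{-k}^0$ $$p\big(z_0\mid K_{-\infty}^{-(k+2)}\,a\,z_{-k}^{-1}\big)=p\big(z_0\mid 1_{-\infty}^{-(k+2)}\,(a+1)\,z_{-k}^{-1}\big).\tag{$*$}$$ Then $T$ is piecewise $C^1$: for each $j$, $T|_{I_j}$ extends to a $C^1$ map on $\overline{I_j}$. 6. If $(*)$ holds and there are $C$ and $\rho\in\,]0,1[$ with $\beta_k\le C\rho^k$ for all $k\ge1$, then $T$ is piecewise $C^{1+\alpha}$: for each $j$, $T|_{I_j}$ extends to a $C^1$ map on $\overline{I_j}$ with $\alpha$-Hölder derivative. Here $\alpha\in\,]0,1]$ depends only on $K$, $\rho$ and $\inf p$. -/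

import Mathlib

open Set Filter Topology MeasureTheory

namespace InfChain

noncomputable section

/-!
The alphabet `{1, …, K}` is `Fin K`, its smallest letter is `⊥`, its largest one `⊤`.
A one-sided sequence `x_{-∞}^0` is coded as `x : ℕ → Fin K`, where `x n` is the symbol at
position `-n`.  A past `x_{-∞}^{-1}` is coded as `x : ℕ → Fin K`, where `x n` is the symbol at
position `-1-n`.
-/

variable {K : ℕ}

/-- The sequence `y_{-∞}^{-1} a`, with `a` at position `0`. -/
def cons (a : Fin K) (y : ℕ → Fin K) : ℕ → Fin K
  | 0 => a
  | n + 1 => y n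

/-- For `x = x_{-∞}^0`, this is the past `x_{-∞}^{-1}`; read as a sequence indexed by the
nonpositive integers it is the shifted sequence `i ↦ x_{i-1}`. -/
def tail (x : ℕ → Fin K) : ℕ → Fin K := fun n => x (n + 1)

/-- The sequence whose first `n` symbols (positions `0, …, -(n-1)`) are those of `z`, which has
`a` at position `-n`, and `c` at all positions before. -/
def splice (n : ℕ) (z : ℕ → Fin K) (a c : Fin K) : ℕ → Fin K :=
  fun i => if i < n then z i else if i = n then a else c

/-- The shift of two-sided sequences. -/
def shift (z : ℤ → Fin K) : ℤ → Fin K := fun i => z (i - 1)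

/-- The part `z_{-∞}^0` of a two-sided sequence. -/
def upToZero (z : ℤ → Fin K) : ℕ → Fin K := fun n => z (-(n : ℤ))

/-- The part `z_{-∞}^{-1}` of a two-sided sequence. -/
def pastOf (z : ℤ → Fin K) : ℕ → Fin K := fun n => z (-1 - (n : ℤ))

/-! ### Families of transition probabilities -/

/-- `p a y` is `p(a | y_{-∞}^{-1})`. -/
structure IsTransitionFamily (p : Fin K → (ℕ → Fin K) → ℝ) : Prop where
  mem_Icc : ∀ a y, p a y ∈ Icc (0 : ℝ) 1
  sum_eq_one : ∀ y, ∑ a, p a y = 1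
  measurable : ∀ a, Measurable (p a)

/-- The infimum of all transition probabilities. -/
def infProb (p : Fin K → (ℕ → Fin K) → ℝ) : ℝ := sInf {r | ∃ a y, r = p a y}

/-- Non-nullness. -/
def IsNonNull (p : Fin K → (ℕ → Fin K) → ℝ) : Prop := 0 < infProb p

/-- The continuity rate `β_k`. -/
def contRate (p : Fin K → (ℕ → Fin K) → ℝ) (k : ℕ) : ℝ :=
  sSup {r | ∃ (a : Fin K) (x y : ℕ → Fin K), (∀ i < k, x i = y i) ∧ r = |p a x - p a y|}

/-- Continuity of the family: `β_k → 0`. -/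
def IsContinuousFamily (p : Fin K → (ℕ → Fin K) → ℝ) : Prop :=
  Tendsto (contRate p) atTop (𝓝 0)

/-- The measure `P` on two-sided sequences is invariant with respect to `p`. -/
def IsInvariantFor (P : Measure (ℤ → Fin K)) (p : Fin K → (ℕ → Fin K) → ℝ) : Prop :=
  ∀ f : (ℕ → Fin K) → ℝ, Continuous f →
    ∫ z, f (upToZero z) ∂P = ∫ z, ∑ a, p a (pastOf z) * f (cons a (pastOf z)) ∂P

/-- The matching condition: for `a' = a + 1` and every word `z_{-k}^0`, `k ≥ 0` (`n = k + 1`), the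
transition probability to `z_0` is the same from the pasts `K_{-∞}^{-(k+2)} a z_{-k}^{-1}` and
`1_{-∞}^{-(k+2)} a' z_{-k}^{-1}`. -/
def Matching [NeZero K] (p : Fin K → (ℕ → Fin K) → ℝ) : Prop :=
  ∀ (n : ℕ), 1 ≤ n → ∀ (z : ℕ → Fin K) (a a' : Fin K), (a' : ℕ) = a + 1 →
    p (z 0) (tail (splice n z a ⊤)) = p (z 0) (tail (splice n z a' ⊥))

/-! ### The map `h`, the exceptional codes, and the interval map -/

/-- The lexicographic order: the symbols closest to position `0` are compared first. -/
def LexLT (x y : ℕ → Fin K) : Prop := ∃ m, (∀ i < m, x i = y i) ∧ x m < y m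

/-- `h(x) = P(y ≤ x)`. -/
def hMap (P : Measure (ℤ → Fin K)) (x : ℕ → Fin K) : ℝ :=
  P.real {z | upToZero z = x ∨ LexLT (upToZero z) x}

/-- The set of exceptional codes. -/
def exceptional (K : ℕ) [NeZero K] : Set (ℕ → Fin K) :=
  {x | ∃ (n : ℕ) (z : ℕ → Fin K) (a a' : Fin K), (a' : ℕ) = a + 1 ∧
    (x = splice n z a ⊤ ∨ x = splice n z a' ⊥)}

/-- `Ω \ h(𝒬)`, with `Ω = [0,1]`. -/
def regularPoints [NeZero K] (P : Measure (ℤ → Fin K)) : Set ℝ :=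
  Icc 0 1 \ hMap P '' exceptional K

/-- The inverse of `h` (used on `Ω \ h(𝒬)`). -/
def hInv [NeZero K] (P : Measure (ℤ → Fin K)) : ℝ → (ℕ → Fin K) := Function.invFun (hMap P)

/-- `h ∘ shift ∘ h⁻¹` (used on `Ω \ h(𝒬)`). -/
def baseMap [NeZero K] (P : Measure (ℤ → Fin K)) (ω : ℝ) : ℝ := hMap P (tail (hInv P ω))

/-- The end points: `η_0 = 0`, and `η_k = h(K_{-∞}^{-1} k)` for `k = 1, …, K`. -/
def endPt [NeZero K] (P : Measure (ℤ → Fin K)) : Fin (K + 1) → ℝ :=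
  Fin.cons 0 (fun a : Fin K => hMap P (cons a (fun _ => ⊤)))

/-! ### Interval maps -/

/-- The open interval of index `j` of the partition with end points `η`. -/
def piece (η : Fin (K + 1) → ℝ) (j : Fin K) : Set ℝ := Ioo (η j.castSucc) (η j.succ)

/-- Its closure, for `η` strictly increasing. -/
def closedPiece (η : Fin (K + 1) → ℝ) (j : Fin K) : Set ℝ := Icc (η j.castSucc) (η j.succ)

/-- The topological Markov property. -/
def IsTopologicalMarkov (T : ℝ → ℝ) (η : Fin (K + 1) → ℝ) : Prop :=
  ∀ i : Fin K, ∃ S : Set (Fin K), closure (T '' piece η i) = ⋃ j ∈ S, closure (piece η j)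

/-- Elements of the dynamical partitions: the points `ω ∈ [0,1]` with `T^j(ω) ∈ I_{y_j}` for
`0 ≤ j < k`. -/
def dynCylinder (T : ℝ → ℝ) (η : Fin (K + 1) → ℝ) (y : ℕ → Fin K) (k : ℕ) : Set ℝ :=
  {ω | ω ∈ Icc (0 : ℝ) 1 ∧ ∀ j < k, T^[j] ω ∈ piece η (y j)}

open Classical in
/-- The coding: the `n`-th symbol is `j` if `T^n(ω) ∈ I_j` (and an irrelevant letter if
`T^n(ω)` is in no interval of the partition). -/
def code [NeZero K] (T : ℝ → ℝ) (η : Fin (K + 1) → ℝ) (ω : ℝ) (n : ℕ) : Fin K :=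
  if hj : ∃ j, T^[n] ω ∈ piece η j then hj.choose else ⊥

/-- `d` is the left derivative of `T` at `ω`, where the value of `T` at `ω` is replaced by the left
limit of `T` (which is the value of `T` wherever `T` is continuous). -/
def HasLeftDeriv (T : ℝ → ℝ) (d ω : ℝ) : Prop :=
  ∃ l, Tendsto T (𝓝[<] ω) (𝓝 l) ∧ Tendsto (fun u => (T u - l) / (u - ω)) (𝓝[<] ω) (𝓝 d)

/-- `d` is the right derivative of `T` at `ω`, where the value of `T` at `ω` is replaced by the
right limit of `T`. -/
def HasRightDeriv (T : ℝ → ℝ) (d ω : ℝ) : Prop :=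
  ∃ l, Tendsto T (𝓝[>] ω) (𝓝 l) ∧ Tendsto (fun u => (T u - l) / (u - ω)) (𝓝[>] ω) (𝓝 d)

/-- Piecewise `C¹`: on each interval `I_j`, `T` extends to a `C¹` map on the closed interval. -/
def IsPiecewiseC1 (T : ℝ → ℝ) (η : Fin (K + 1) → ℝ) : Prop :=
  ∀ j : Fin K, ∃ g : ℝ → ℝ, EqOn T g (piece η j) ∧ ContDiffOn ℝ 1 g (closedPiece η j)

/-- Piecewise `C^{1+α}`: on each interval `I_j`, `T` extends to a `C¹` map on the closed interval
whose derivative is `α`-Hölder. -/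
def IsPiecewiseC1Holder (T : ℝ → ℝ) (η : Fin (K + 1) → ℝ) (α : ℝ) : Prop :=
  ∀ j : Fin K, ∃ g : ℝ → ℝ, EqOn T g (piece η j) ∧ ContDiffOn ℝ 1 g (closedPiece η j) ∧
    ∃ C : ℝ, ∀ u ∈ closedPiece η j, ∀ v ∈ closedPiece η j,
      |derivWithin g (closedPiece η j) u - derivWithin g (closedPiece η j) v| ≤ C * |u - v| ^ α

end

end InfChain

open InfChain

/-!
The law `μ` of `z_{-∞}^0` is a measure on sequences that is invariant and ergodic for `tail`, and by
the invariance with respect to `p`, prefixing a symbol `a` multiplies `μ` by the density `p a`: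
`μ {x | x 0 = a ∧ tail x ∈ B} = ∫ y in B, p a y ∂μ` (`measureReal_zero_tail_eq_setIntegral`; the
facts used about `μ` are collected in `IsChainLaw`). The map `h` is the distribution function `cdf μ`
of `μ` for the lexicographic order. Non-nullness gives every cylinder of length `n` a measure
between `ε ^ n` and `(1 - ε) ^ n`, so `cdf μ` is continuous, maps onto `[0, 1]`, carries `μ` to Lebesgue
measure (`measurePreserving_cdf`), and identifies two sequences only if they are lexicographic
neighbours (`exists_splice_of_cdf_eq`); the neighbours are exactly the pairs defining `𝒬`.

The interval map is the shift read through `cdf μ`. Invariance, ergodicity and the conditional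
probabilities are transported from `μ`, since almost every point is coded by its itinerary
(`ae_code_cdf`).

For two sequences with first symbol `a`, the increment of `cdf μ` is the integral of `p a` over the
pasts in between (`cdf_sub_eq_setIntegral`), while the increment of `cdf μ` along the pasts is the
`μ`-measure of the same set. Hence a difference quotient of the interval map is the reciprocal of
an average of `p a` (`tendsto_slope_of_prob`). By compactness, the codes of points
approaching `h(x)` converge to `x`, or, from one side, to the corresponding one of the two codes;
the derivatives follow from the continuity of `p`.

Under the matching condition `p` is a function of the coded point on each closed interval, so the
derivative is continuous there (`exists_extension_of_matching`). For Hölder continuity two codes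
with first difference at position `n` are compared through the two neighbours between them: if a
code agrees with a neighbour exactly up to position `m`, a cylinder of length `m + 1` lies between
them, so that their images are at distance at least `ε ^ (m + 1)`, whereas the values of `p` differ
by at most a constant times `ρ ^ m`. Any exponent `α` with `ρ ≤ ε ^ α` therefore works
(`abs_prob_sub_le_rpow_of_lt`).
-/

namespace InfChain

variable {K : ℕ}

/-! ### Sequences and their lexicographic order -/

/-- The set of sequences that share the first `n` symbols of `x`. -/
def cylinder (x : ℕ → Fin K) (n : ℕ) : Set (ℕ → Fin K) := {y | ∀ i < n, y i = x i}

theorem mem_cylinder {x y : ℕ → Fin K} {n : ℕ} : y ∈ cylinder x n ↔ ∀ i < n, y i = x i := Iff.rfl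

theorem isClopen_cylinder (x : ℕ → Fin K) (n : ℕ) : IsClopen (cylinder x n) := by
  have : cylinder x n = ⋂ i ∈ Finset.range n, (fun y : ℕ → Fin K => y i) ⁻¹' {x i} := by
    ext y; simp [cylinder]
  rw [this]
  exact isClopen_biInter_finset fun i _ => (isClopen_discrete _).preimage (continuous_apply i)

theorem cylinder_mem_nhds (x : ℕ → Fin K) (n : ℕ) : cylinder x n ∈ 𝓝 x :=
  (isClopen_cylinder x n).isOpen.mem_nhds fun _ _ => rfl

@[simp] theorem cons_zero (a : Fin K) (y : ℕ → Fin K) : cons a y 0 = a := rfl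

@[simp] theorem cons_succ (a : Fin K) (y : ℕ → Fin K) (n : ℕ) : cons a y (n + 1) = y n := rfl

@[simp] theorem tail_apply (y : ℕ → Fin K) (n : ℕ) : tail y n = y (n + 1) := rfl

@[simp] theorem tail_cons (a : Fin K) (y : ℕ → Fin K) : tail (cons a y) = y := rfl

@[simp] theorem cons_tail (x : ℕ → Fin K) : cons (x 0) (tail x) = x := by
  funext n; cases n <;> rfl

theorem continuous_tail : Continuous (tail : (ℕ → Fin K) → ℕ → Fin K) :=
  continuous_pi fun _ => continuous_apply _

theorem measurable_tail : Measurable (tail : (ℕ → Fin K) → ℕ → Fin K) :=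
  measurable_pi_lambda _ fun _ => measurable_pi_apply _

theorem tail_iterate_zero (x : ℕ → Fin K) (n : ℕ) : tail^[n] x 0 = x n := by
  have : ∀ i, tail^[n] x i = x (n + i) := by
    induction n with
    | zero => intro i; simp
    | succ n ih =>
      intro i
      rw [Function.iterate_succ_apply', tail_apply, ih]
      congr 1; omega
  exact this 0

theorem cylinder_succ (x : ℕ → Fin K) (n : ℕ) :
    cylinder x (n + 1) = {y | y 0 = x 0 ∧ tail y ∈ cylinder (tail x) n} := by
  ext y
  simp only [mem_cylinder, mem_ofPred_eq, tail_apply]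
  refine ⟨fun h => ⟨h 0 n.succ_pos, fun i hi => h (i + 1) (by omega)⟩, fun h i hi => ?_⟩
  cases i with
  | zero => exact h.1
  | succ i => exact h.2 i (by omega)

theorem lex_lt_iff {x y : ℕ → Fin K} :
    toLex x < toLex y ↔ ∃ m, (∀ i < m, x i = y i) ∧ x m < y m := Iff.rfl

theorem lex_not_lt {x y : ℕ → Fin K} : ¬ toLex x < toLex y ↔ toLex y ≤ toLex x := not_lt

theorem lex_lt_of_zero_lt {x y : ℕ → Fin K} (h : x 0 < y 0) : toLex x < toLex y :=
  ⟨0, fun _ hi => absurd hi (Nat.not_lt_zero _), h⟩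

theorem zero_le_of_lex_le {x y : ℕ → Fin K} (h : toLex x ≤ toLex y) : x 0 ≤ y 0 :=
  not_lt.1 fun h' => absurd (lex_lt_of_zero_lt h') (not_lt.2 h)

theorem isOpen_lex_lt (x : ℕ → Fin K) : IsOpen {y | toLex y < toLex x} := by
  refine isOpen_iff_mem_nhds.2 fun y ⟨m, h1, h2⟩ => ?_
  filter_upwards [cylinder_mem_nhds y (m + 1)] with w hw
  refine ⟨m, fun i hi => (hw i (by omega)).trans (h1 i hi), ?_⟩
  change w m < x m
  rw [hw m (by omega)]; exact h2

theorem isOpen_lex_gt (x : ℕ → Fin K) : IsOpen {y | toLex x < toLex y} := by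
  refine isOpen_iff_mem_nhds.2 fun y ⟨m, h1, h2⟩ => ?_
  filter_upwards [cylinder_mem_nhds y (m + 1)] with w hw
  refine ⟨m, fun i hi => (h1 i hi).trans (hw i (by omega)).symm, ?_⟩
  change x m < w m
  rw [hw m (by omega)]; exact h2

theorem isClosed_lex_le (x : ℕ → Fin K) : IsClosed {y | toLex y ≤ toLex x} := by
  convert (isOpen_lex_gt x).isClosed_compl using 1
  ext y; exact lex_not_lt.symm

theorem isClosed_lex_ge (x : ℕ → Fin K) : IsClosed {y | toLex x ≤ toLex y} := by
  convert (isOpen_lex_lt x).isClosed_compl using 1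
  ext y; exact lex_not_lt.symm

theorem lex_le_of_le {x y : ℕ → Fin K} (h : ∀ i, x i ≤ y i) : toLex x ≤ toLex y :=
  Pi.toLex_monotone h

/-- Sequences between two members of a cylinder belong to it: cylinders are order intervals. -/
theorem agree_of_between {x w y : ℕ → Fin K} {n : ℕ} (h1 : toLex x ≤ toLex w)
    (h2 : toLex w ≤ toLex y) (h : ∀ i < n, x i = y i) : ∀ i < n, w i = x i := by
  rcases h1.eq_or_lt with h1 | ⟨m, hm, hlt⟩
  · intro i _; exact (congrFun (toLex.injective h1) i).symm
  · by_cases hmn : n ≤ m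
    · exact fun i hi => (hm i (by omega)).symm
    · refine absurd h2 (not_le.2 ⟨m, fun i hi => ?_, ?_⟩)
      · exact (h i (by omega)).symm.trans (hm i hi)
      · change y m < w m
        rw [← h m (by omega)]; exact hlt

theorem cons_lex_lt_cons {a : Fin K} {y y' : ℕ → Fin K} :
    toLex (cons a y) < toLex (cons a y') ↔ toLex y < toLex y' := by
  constructor
  · rintro ⟨m, h1, h2⟩
    cases m with
    | zero => exact absurd h2 (lt_irrefl _)
    | succ m => exact ⟨m, fun i hi => h1 (i + 1) (by omega), h2⟩
  · rintro ⟨m, h1, h2⟩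
    refine ⟨m + 1, fun i hi => ?_, h2⟩
    cases i with
    | zero => rfl
    | succ i => exact h1 i (by omega)

theorem cons_lex_le_cons {a : Fin K} {y y' : ℕ → Fin K} :
    toLex (cons a y) ≤ toLex (cons a y') ↔ toLex y ≤ toLex y' := by
  rw [← lex_not_lt, cons_lex_lt_cons, lex_not_lt]

theorem tail_lex_lt_tail {x y : ℕ → Fin K} (h : x 0 = y 0) :
    toLex (tail x) < toLex (tail y) ↔ toLex x < toLex y := by
  rw [← cons_lex_lt_cons (a := x 0), cons_tail, h, cons_tail]

theorem tail_lex_le_tail {x y : ℕ → Fin K} (h : x 0 = y 0) :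
    toLex (tail x) ≤ toLex (tail y) ↔ toLex x ≤ toLex y := by
  rw [← cons_lex_le_cons (a := x 0), cons_tail, h, cons_tail]

theorem splice_of_lt {n i : ℕ} (h : i < n) (z : ℕ → Fin K) (a c : Fin K) :
    splice n z a c i = z i := by simp [splice, h]

@[simp] theorem splice_self (n : ℕ) (z : ℕ → Fin K) (a c : Fin K) : splice n z a c n = a := by
  simp [splice]

theorem splice_of_gt {n i : ℕ} (h : n < i) (z : ℕ → Fin K) (a c : Fin K) :
    splice n z a c i = c := by
  simp [splice, h.not_gt, h.ne']

theorem splice_zero (z : ℕ → Fin K) (a c : Fin K) : splice 0 z a c = cons a fun _ => c := by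
  funext i; cases i <;> simp [splice]

variable [NeZero K]

/-- A sequence that agrees with `splice n z a ⊤` up to the position of `a` lies below it. -/
theorem lex_le_splice_top {w z : ℕ → Fin K} {a : Fin K} {n m : ℕ} (hnm : n ≤ m)
    (h : ∀ i ≤ m, w i = splice n z a ⊤ i) : toLex w ≤ toLex (splice n z a ⊤) := by
  refine lex_le_of_le fun i => ?_
  by_cases hi : i ≤ m
  · exact (h i hi).le
  · rw [splice_of_gt (by omega)]; exact le_top

theorem splice_bot_lex_le {w z : ℕ → Fin K} {a : Fin K} {n m : ℕ} (hnm : n ≤ m)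
    (h : ∀ i ≤ m, w i = splice n z a ⊥ i) : toLex (splice n z a ⊥) ≤ toLex w := by
  refine lex_le_of_le fun i => ?_
  by_cases hi : i ≤ m
  · exact (h i hi).ge
  · rw [splice_of_gt (by omega)]; exact bot_le

/-- If `w` is below `splice n z a ⊤` and starts with the same word `z` of length `n`, then a whole
cylinder around `splice n z a ⊤`, of the length given by the first difference, fits between
the two in the sense of order. -/
theorem exists_cylinder_between_top {w z : ℕ → Fin K} {a : Fin K} {n : ℕ}
    (hw : ∀ i < n, w i = z i) (hlt : toLex w < toLex (splice n z a ⊤)) :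
    ∃ m, n ≤ m ∧ (∀ i < m, w i = splice n z a ⊤ i) ∧
      ∀ v ∈ cylinder (splice n z a ⊤) (m + 1),
        toLex w < toLex v ∧ toLex v ≤ toLex (splice n z a ⊤) := by
  obtain ⟨m, h1, h2⟩ := lex_lt_iff.1 hlt
  have hnm : n ≤ m := by
    by_contra hc
    rw [splice_of_lt (by omega), hw m (by omega)] at h2
    exact lt_irrefl _ h2
  refine ⟨m, hnm, h1, fun v hv => ⟨⟨m, fun i hi => ?_, ?_⟩, ?_⟩⟩
  · exact (h1 i hi).trans (hv i (by omega)).symm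
  · change w m < v m
    rw [hv m (by omega)]; exact h2
  · exact lex_le_splice_top hnm fun i hi => hv i (by omega)

theorem exists_cylinder_between_bot {w z : ℕ → Fin K} {a : Fin K} {n : ℕ}
    (hw : ∀ i < n, w i = z i) (hlt : toLex (splice n z a ⊥) < toLex w) :
    ∃ m, n ≤ m ∧ (∀ i < m, w i = splice n z a ⊥ i) ∧
      ∀ v ∈ cylinder (splice n z a ⊥) (m + 1),
        toLex (splice n z a ⊥) ≤ toLex v ∧ toLex v < toLex w := by
  obtain ⟨m, h1, h2⟩ := lex_lt_iff.1 hlt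
  have hnm : n ≤ m := by
    by_contra hc
    rw [splice_of_lt (by omega), hw m (by omega)] at h2
    exact lt_irrefl _ h2
  refine ⟨m, hnm, fun i hi => (h1 i hi).symm, fun v hv => ⟨?_, ⟨m, fun i hi => ?_, ?_⟩⟩⟩
  · exact splice_bot_lex_le hnm fun i hi => hv i (by omega)
  · exact (hv i (by omega)).trans (h1 i hi)
  · change v m < w m
    rw [hv m (by omega)]; exact h2

theorem splice_top_lex_lt_splice_bot {n : ℕ} {z : ℕ → Fin K} {a a' : Fin K}
    (h : (a' : ℕ) = a + 1) : toLex (splice n z a ⊤) < toLex (splice n z a' ⊥) := by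
  refine ⟨n, fun i hi => ?_, ?_⟩
  · change splice n z a ⊤ i = splice n z a' ⊥ i
    rw [splice_of_lt hi, splice_of_lt hi]
  · change splice n z a ⊤ n < splice n z a' ⊥ n
    rw [splice_self, splice_self, Fin.lt_def]; omega

/-- Nothing lies strictly between `splice n z a ⊤` and `splice n z (a + 1) ⊥`. -/
theorem eq_of_splice_top_lt_of_le_splice_bot {n : ℕ} {z w : ℕ → Fin K} {a a' : Fin K}
    (h : (a' : ℕ) = a + 1) (h1 : toLex (splice n z a ⊤) < toLex w)
    (h2 : toLex w ≤ toLex (splice n z a' ⊥)) : w = splice n z a' ⊥ := by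
  have hw : ∀ i < n, w i = z i := fun i hi => by
    rw [agree_of_between h1.le h2 (n := n) (fun i hi => by
      rw [splice_of_lt hi, splice_of_lt hi]) i hi, splice_of_lt hi]
  have hwn : w n = a' := by
    rcases lt_trichotomy (w n) a' with hlt | heq | hgt
    · have hle : w n ≤ a := by rw [Fin.le_def]; rw [Fin.lt_def] at hlt; omega
      refine absurd h1 (not_lt.2 (lex_le_of_le fun i => ?_))
      rcases lt_trichotomy i n with hi | rfl | hi
      · rw [splice_of_lt hi, hw i hi]
      · rwa [splice_self]
      · rw [splice_of_gt hi]; exact le_top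
    · exact heq
    · refine absurd h2 (not_le.2 ⟨n, fun i hi => ?_, ?_⟩)
      · exact (splice_of_lt hi _ _ _).trans (hw i hi).symm
      · change splice n z a' ⊥ n < w n
        rwa [splice_self]
  refine toLex.injective (le_antisymm h2 (splice_bot_lex_le le_rfl fun i hi => ?_))
  rcases hi.lt_or_eq with hi | rfl
  · rw [splice_of_lt hi, hw i hi]
  · rw [splice_self, hwn]

/-- Between two sequences `x < y` there is a pair of neighbours `splice n x a ⊤`,
`splice n x (a + 1) ⊥`, where `n` is the first position at which `x` and `y` differ. -/
theorem exists_splice_between {x y : ℕ → Fin K} (h : toLex x < toLex y) :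
    ∃ (n : ℕ) (a' : Fin K), (∀ i < n, x i = y i) ∧ x n < y n ∧ (a' : ℕ) = x n + 1 ∧
      toLex x ≤ toLex (splice n x (x n) ⊤) ∧ toLex (splice n x a' ⊥) ≤ toLex y := by
  obtain ⟨n, h1, h2⟩ := lex_lt_iff.1 h
  have hval : (x n : ℕ) + 1 ≤ y n := h2
  obtain ⟨a', ha'⟩ : ∃ a' : Fin K, (a' : ℕ) = x n + 1 := ⟨⟨x n + 1, by omega⟩, rfl⟩
  refine ⟨n, a', h1, h2, ha', lex_le_splice_top le_rfl fun i hi => ?_, lex_le_of_le fun i => ?_⟩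
  · rcases hi.lt_or_eq with hi | rfl
    · rw [splice_of_lt hi]
    · rw [splice_self]
  · rcases lt_trichotomy i n with hi | rfl | hi
    · rw [splice_of_lt hi, h1 i hi]
    · rw [splice_self, Fin.le_def]; omega
    · rw [splice_of_gt hi]; exact bot_le

end InfChain

namespace InfChain

/-! ### One-sided laws with prescribed transition probabilities -/

/-- `μ` is a law of the one-sided sequence `x_{-∞}^0` that is reproduced when a past distributed
according to `μ` is continued at position `0` by a symbol drawn with the probabilities `p`; the
transition probabilities stay at distance `ε > 0` from `0` and `1`, and they are uniformly
continuous functions of the past. -/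
structure IsChainLaw {K : ℕ} (p : Fin K → (ℕ → Fin K) → ℝ) (ε : ℝ) (μ : Measure (ℕ → Fin K)) :
    Prop where
  two_le : 2 ≤ K
  isProb : IsProbabilityMeasure μ
  measurable : ∀ a, Measurable (p a)
  pos : 0 < ε
  le : ∀ a y, ε ≤ p a y
  le_one_sub : ∀ a y, p a y ≤ 1 - ε
  unif : ∀ δ > 0, ∃ n, ∀ (a : Fin K) (x y : ℕ → Fin K), (∀ i < n, x i = y i) → |p a x - p a y| ≤ δ
  step : ∀ (a : Fin K) (B : Set (ℕ → Fin K)), MeasurableSet B →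
    μ.real {x | x 0 = a ∧ tail x ∈ B} = ∫ y in B, p a y ∂μ

/-- The distribution function of `μ` for the lexicographic order. -/
noncomputable def cdf {K : ℕ} (μ : Measure (ℕ → Fin K)) (x : ℕ → Fin K) : ℝ :=
  μ.real {y | toLex y ≤ toLex x}

variable {K : ℕ} {p : Fin K → (ℕ → Fin K) → ℝ} {ε : ℝ} {μ : Measure (ℕ → Fin K)}

/-- The set of sequences `w` with `x < w ≤ y`. -/
def lexIoc (x y : ℕ → Fin K) : Set (ℕ → Fin K) := {w | toLex x < toLex w ∧ toLex w ≤ toLex y}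

theorem measurableSet_lexIoc (x y : ℕ → Fin K) : MeasurableSet (lexIoc x y) :=
  (isOpen_lex_gt x).measurableSet.inter (isClosed_lex_le y).measurableSet

namespace IsChainLaw

theorem eps_lt_one (hμ : IsChainLaw p ε μ) : ε < 1 := by
  have a : Fin K := ⟨0, by have := hμ.two_le; omega⟩
  have y : ℕ → Fin K := fun _ => a
  have h1 := hμ.le a y
  have h2 := hμ.le_one_sub a y
  have h3 := hμ.pos
  linarith

theorem prob_pos (hμ : IsChainLaw p ε μ) (a : Fin K) (y : ℕ → Fin K) : 0 < p a y :=
  hμ.pos.trans_le (hμ.le a y)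

theorem prob_lt_one (hμ : IsChainLaw p ε μ) (a : Fin K) (y : ℕ → Fin K) : p a y < 1 := by
  have h1 := hμ.le_one_sub a y
  have h2 := hμ.pos
  linarith

theorem continuous_prob (hμ : IsChainLaw p ε μ) (a : Fin K) : Continuous (p a) := by
  refine continuous_iff_continuousAt.2 fun x => Metric.tendsto_nhds.2 fun δ hδ => ?_
  obtain ⟨n, hn⟩ := hμ.unif (δ / 2) (half_pos hδ)
  filter_upwards [cylinder_mem_nhds x n] with y hy
  rw [Real.dist_eq]
  exact (hn _ _ _ hy).trans_lt (half_lt_self hδ)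

theorem integrable (hμ : IsChainLaw p ε μ) (a : Fin K) : Integrable (p a) μ := by
  have := hμ.isProb
  refine Integrable.of_bound (hμ.measurable a).aestronglyMeasurable 1 (ae_of_all _ fun y => ?_)
  rw [Real.norm_eq_abs, abs_of_pos (hμ.prob_pos a y)]
  exact (hμ.prob_lt_one a y).le

theorem mul_measureReal_le (hμ : IsChainLaw p ε μ) (a : Fin K) {B : Set (ℕ → Fin K)}
    (hB : MeasurableSet B) : ε * μ.real B ≤ μ.real {x | x 0 = a ∧ tail x ∈ B} := by
  have := hμ.isProb
  rw [hμ.step a B hB]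
  calc ε * μ.real B = ∫ _ in B, ε ∂μ := by rw [setIntegral_const, smul_eq_mul, mul_comm]
    _ ≤ _ := setIntegral_mono (integrable_const _).integrableOn (hμ.integrable a).integrableOn
        fun y => hμ.le a y

theorem measureReal_le_mul (hμ : IsChainLaw p ε μ) (a : Fin K) {B : Set (ℕ → Fin K)}
    (hB : MeasurableSet B) : μ.real {x | x 0 = a ∧ tail x ∈ B} ≤ (1 - ε) * μ.real B := by
  have := hμ.isProb
  rw [hμ.step a B hB]
  calc _ ≤ ∫ _ in B, (1 - ε) ∂μ := setIntegral_mono (hμ.integrable a).integrableOn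
        (integrable_const _).integrableOn fun y => hμ.le_one_sub a y
    _ = (1 - ε) * μ.real B := by rw [setIntegral_const, smul_eq_mul, mul_comm]

theorem pow_le_measureReal_cylinder (hμ : IsChainLaw p ε μ) (x : ℕ → Fin K) (n : ℕ) :
    ε ^ n ≤ μ.real (cylinder x n) := by
  have := hμ.isProb
  induction n generalizing x with
  | zero => simp [cylinder]
  | succ n ih =>
    rw [cylinder_succ, pow_succ']
    exact (mul_le_mul_of_nonneg_left (ih (tail x)) hμ.pos.le).trans
      (hμ.mul_measureReal_le _ (isClopen_cylinder _ _).isOpen.measurableSet)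

theorem measureReal_cylinder_le_pow (hμ : IsChainLaw p ε μ) (x : ℕ → Fin K) (n : ℕ) :
    μ.real (cylinder x n) ≤ (1 - ε) ^ n := by
  have := hμ.isProb
  induction n generalizing x with
  | zero => simp [cylinder]
  | succ n ih =>
    rw [cylinder_succ, pow_succ']
    exact (hμ.measureReal_le_mul _ (isClopen_cylinder _ _).isOpen.measurableSet).trans
      (mul_le_mul_of_nonneg_left (ih (tail x)) (sub_pos.2 hμ.eps_lt_one).le)

theorem tendsto_one_sub_pow (hμ : IsChainLaw p ε μ) :
    Tendsto (fun n : ℕ => (1 - ε) ^ n) atTop (𝓝 0) :=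
  tendsto_pow_atTop_nhds_zero_of_lt_one (sub_pos.2 hμ.eps_lt_one).le (by linarith [hμ.pos])

theorem measureReal_singleton (hμ : IsChainLaw p ε μ) (x : ℕ → Fin K) : μ.real {x} = 0 := by
  have := hμ.isProb
  refine le_antisymm (ge_of_tendsto' hμ.tendsto_one_sub_pow fun n => ?_) measureReal_nonneg
  refine (measureReal_mono ?_).trans (hμ.measureReal_cylinder_le_pow x n)
  rintro _ rfl _ _
  rfl

/-! ### The distribution function -/

theorem cdf_mono (hμ : IsChainLaw p ε μ) {x y : ℕ → Fin K} (h : toLex x ≤ toLex y) :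
    cdf μ x ≤ cdf μ y := by
  have := hμ.isProb
  exact measureReal_mono fun w (hw : toLex w ≤ toLex x) => (hw.trans h : toLex w ≤ toLex y)

theorem cdf_mem_Icc (hμ : IsChainLaw p ε μ) (x : ℕ → Fin K) : cdf μ x ∈ Icc (0 : ℝ) 1 := by
  have := hμ.isProb
  exact ⟨measureReal_nonneg, measureReal_le_one⟩

theorem cdf_sub (hμ : IsChainLaw p ε μ) {x y : ℕ → Fin K} (h : toLex x ≤ toLex y) :
    cdf μ y - cdf μ x = μ.real (lexIoc x y) := by
  have := hμ.isProb
  have hsub : {w | toLex w ≤ toLex x} ⊆ {w | toLex w ≤ toLex y} := fun w hw => le_trans hw h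
  rw [cdf, cdf, ← measureReal_sdiff hsub (isClosed_lex_le x).measurableSet]
  congr 1
  ext w
  exact ⟨fun hw => ⟨not_le.1 hw.2, hw.1⟩, fun hw => ⟨hw.2, not_le.2 hw.1⟩⟩

theorem lex_lt_of_cdf_lt (hμ : IsChainLaw p ε μ) {x y : ℕ → Fin K} (h : cdf μ x < cdf μ y) :
    toLex x < toLex y :=
  not_le.1 fun h' => absurd (hμ.cdf_mono h') (not_le.2 h)

theorem cdf_sub_le_pow (hμ : IsChainLaw p ε μ) {x y : ℕ → Fin K} {n : ℕ}
    (h : toLex x ≤ toLex y) (hxy : ∀ i < n, x i = y i) : cdf μ y - cdf μ x ≤ (1 - ε) ^ n := by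
  have := hμ.isProb
  rw [hμ.cdf_sub h]
  exact (measureReal_mono fun w hw => agree_of_between hw.1.le hw.2 hxy).trans
    (hμ.measureReal_cylinder_le_pow x n)

theorem pow_le_cdf_sub (hμ : IsChainLaw p ε μ) {x y v : ℕ → Fin K} {n : ℕ}
    (h : ∀ w ∈ cylinder v n, toLex x < toLex w ∧ toLex w ≤ toLex y) :
    ε ^ n ≤ cdf μ y - cdf μ x := by
  have := hμ.isProb
  obtain ⟨h1, h2⟩ := h v fun _ _ => rfl
  rw [hμ.cdf_sub (h1.le.trans h2)]
  exact (hμ.pow_le_measureReal_cylinder v n).trans (measureReal_mono h)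

/-- As points have measure zero, the left end point of a cylinder may be included. -/
theorem pow_le_cdf_sub' (hμ : IsChainLaw p ε μ) {x y v : ℕ → Fin K} {n : ℕ}
    (h : ∀ w ∈ cylinder v n, toLex x ≤ toLex w ∧ toLex w < toLex y) :
    ε ^ n ≤ cdf μ y - cdf μ x := by
  have := hμ.isProb
  obtain ⟨h1, h2⟩ := h v fun _ _ => rfl
  rw [hμ.cdf_sub (h1.trans h2.le)]
  refine (hμ.pow_le_measureReal_cylinder v n).trans ?_
  have hsub : cylinder v n ⊆ lexIoc x y ∪ {x} := fun w hw => by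
    rcases (h w hw).1.eq_or_lt with h' | h'
    · exact Or.inr (toLex.injective h').symm
    · exact Or.inl ⟨h', (h w hw).2.le⟩
  refine (measureReal_mono hsub).trans ((measureReal_union_le _ _).trans ?_)
  rw [hμ.measureReal_singleton, add_zero]

theorem abs_cdf_sub_le (hμ : IsChainLaw p ε μ) {x y : ℕ → Fin K} {n : ℕ}
    (hxy : ∀ i < n, x i = y i) : |cdf μ y - cdf μ x| ≤ (1 - ε) ^ n := by
  rcases le_total (toLex x) (toLex y) with h | h
  · rw [abs_of_nonneg (sub_nonneg.2 (hμ.cdf_mono h))]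
    exact hμ.cdf_sub_le_pow h hxy
  · rw [abs_sub_comm, abs_of_nonneg (sub_nonneg.2 (hμ.cdf_mono h))]
    exact hμ.cdf_sub_le_pow h fun i hi => (hxy i hi).symm

theorem continuous_cdf (hμ : IsChainLaw p ε μ) : Continuous (cdf μ) := by
  refine continuous_iff_continuousAt.2 fun x => Metric.tendsto_nhds.2 fun δ hδ => ?_
  obtain ⟨n, hn⟩ := (hμ.tendsto_one_sub_pow.eventually (gt_mem_nhds hδ)).exists
  filter_upwards [cylinder_mem_nhds x n] with y hy
  rw [Real.dist_eq]
  exact (hμ.abs_cdf_sub_le fun i hi => (hy i hi).symm).trans_lt hn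

/-- The increments of the distribution function on sequences starting with the same symbol are
integrals of the transition probability over the increments of their pasts. -/
theorem cdf_sub_eq_setIntegral (hμ : IsChainLaw p ε μ) {x y : ℕ → Fin K} (h0 : x 0 = y 0)
    (h : toLex x ≤ toLex y) :
    cdf μ y - cdf μ x = ∫ w in lexIoc (tail x) (tail y), p (x 0) w ∂μ := by
  rw [hμ.cdf_sub h, ← hμ.step _ _ (measurableSet_lexIoc _ _)]
  congr 1
  ext w
  constructor
  · intro hw
    have hw0 : w 0 = x 0 := agree_of_between (n := 1) hw.1.le hw.2
      (fun i hi => by rwa [Nat.lt_one_iff.1 hi]) 0 one_pos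
    exact ⟨hw0, (tail_lex_lt_tail hw0.symm).2 hw.1, (tail_lex_le_tail (hw0.trans h0)).2 hw.2⟩
  · rintro ⟨hw0, h1, h2⟩
    exact ⟨(tail_lex_lt_tail hw0.symm).1 h1, (tail_lex_le_tail (hw0.trans h0)).1 h2⟩

/-- If the transition probability is `δ`-close to `d` on the pasts between `x` and `y`, then
the distribution function has slope `d` between the two, up to an error `δ`. -/
theorem abs_cdf_sub_sub_mul_le_of_le (hμ : IsChainLaw p ε μ) {x y : ℕ → Fin K} {d δ : ℝ}
    (h0 : x 0 = y 0) (h : toLex x ≤ toLex y)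
    (hd : ∀ w ∈ lexIoc (tail x) (tail y), |p (x 0) w - d| ≤ δ) :
    |(cdf μ y - cdf μ x) - d * (cdf μ (tail y) - cdf μ (tail x))| ≤
      δ * |cdf μ (tail y) - cdf μ (tail x)| := by
  have := hμ.isProb
  have ht := (tail_lex_le_tail h0).2 h
  have hI := hμ.cdf_sub ht
  rw [abs_of_nonneg (sub_nonneg.2 (hμ.cdf_mono ht)), hI, hμ.cdf_sub_eq_setIntegral h0 h]
  have : ∫ w in lexIoc (tail x) (tail y), (p (x 0) w - d) ∂μ =
      (∫ w in lexIoc (tail x) (tail y), p (x 0) w ∂μ) - d * μ.real (lexIoc (tail x) (tail y)) := by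
    rw [integral_sub (hμ.integrable _).integrableOn (integrable_const _).integrableOn,
      setIntegral_const, smul_eq_mul, mul_comm d]
  rw [← this]
  exact norm_setIntegral_le_of_norm_le_const
    (f := fun w => p (x 0) w - d) (measure_lt_top μ (lexIoc (tail x) (tail y))) hd

theorem abs_cdf_sub_sub_mul_le (hμ : IsChainLaw p ε μ) {x y : ℕ → Fin K} {d δ : ℝ}
    (h0 : x 0 = y 0)
    (hd : ∀ w ∈ lexIoc (tail x) (tail y) ∪ lexIoc (tail y) (tail x), |p (x 0) w - d| ≤ δ) :
    |(cdf μ y - cdf μ x) - d * (cdf μ (tail y) - cdf μ (tail x))| ≤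
      δ * |cdf μ (tail y) - cdf μ (tail x)| := by
  rcases le_total (toLex x) (toLex y) with h | h
  · exact hμ.abs_cdf_sub_sub_mul_le_of_le h0 h fun w hw => hd w (Or.inl hw)
  · have := hμ.abs_cdf_sub_sub_mul_le_of_le (d := d) (δ := δ) h0.symm h fun w hw => by
      rw [← h0]; exact hd w (Or.inr hw)
    rw [abs_sub_comm (cdf μ (tail y)), ← abs_neg]
    convert this using 2
    ring

theorem mul_cdf_tail_sub_le (hμ : IsChainLaw p ε μ) {x y : ℕ → Fin K} (h0 : x 0 = y 0)
    (h : toLex x ≤ toLex y) : ε * (cdf μ (tail y) - cdf μ (tail x)) ≤ cdf μ y - cdf μ x := by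
  rw [hμ.cdf_sub_eq_setIntegral h0 h, hμ.cdf_sub ((tail_lex_le_tail h0).2 h),
    ← hμ.step _ _ (measurableSet_lexIoc _ _)]
  exact hμ.mul_measureReal_le _ (measurableSet_lexIoc _ _)

theorem cdf_sub_le_cdf_tail_sub (hμ : IsChainLaw p ε μ) {x y : ℕ → Fin K} (h0 : x 0 = y 0)
    (h : toLex x ≤ toLex y) : cdf μ y - cdf μ x ≤ cdf μ (tail y) - cdf μ (tail x) := by
  have := hμ.isProb
  rw [hμ.cdf_sub_eq_setIntegral h0 h, hμ.cdf_sub ((tail_lex_le_tail h0).2 h),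
    ← hμ.step _ _ (measurableSet_lexIoc _ _)]
  refine (hμ.measureReal_le_mul _ (measurableSet_lexIoc _ _)).trans ?_
  exact mul_le_of_le_one_left measureReal_nonneg (by linarith [hμ.pos])

theorem abs_cdf_tail_sub_le (hμ : IsChainLaw p ε μ) {x y : ℕ → Fin K} (h0 : x 0 = y 0) :
    |cdf μ (tail y) - cdf μ (tail x)| ≤ ε⁻¹ * |cdf μ y - cdf μ x| := by
  rw [inv_mul_eq_div, le_div_iff₀' hμ.pos]
  rcases le_total (toLex x) (toLex y) with h | h
  · rw [abs_of_nonneg (sub_nonneg.2 (hμ.cdf_mono h)),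
      abs_of_nonneg (sub_nonneg.2 (hμ.cdf_mono ((tail_lex_le_tail h0).2 h)))]
    exact hμ.mul_cdf_tail_sub_le h0 h
  · rw [abs_sub_comm, abs_sub_comm (cdf μ y), abs_of_nonneg (sub_nonneg.2 (hμ.cdf_mono h)),
      abs_of_nonneg (sub_nonneg.2 (hμ.cdf_mono ((tail_lex_le_tail h0.symm).2 h)))]
    exact hμ.mul_cdf_tail_sub_le h0.symm h

/-- Whether two sequences with the same first symbol are identified by the distribution function
is decided by their pasts. -/
theorem cdf_tail_eq_iff (hμ : IsChainLaw p ε μ) {x y : ℕ → Fin K} (h0 : x 0 = y 0) :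
    cdf μ (tail x) = cdf μ (tail y) ↔ cdf μ x = cdf μ y := by
  constructor
  · intro h
    rcases le_total (toLex x) (toLex y) with hl | hl
    · refine le_antisymm (hμ.cdf_mono hl) ?_
      linarith [hμ.cdf_sub_le_cdf_tail_sub h0 hl]
    · refine le_antisymm ?_ (hμ.cdf_mono hl)
      linarith [hμ.cdf_sub_le_cdf_tail_sub h0.symm hl]
  · intro h
    have := hμ.abs_cdf_tail_sub_le h0
    rw [h, sub_self, abs_zero, mul_zero] at this
    exact (sub_eq_zero.1 (abs_nonpos_iff.1 this)).symm

variable [NeZero K]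

theorem bot_lt_top (hμ : IsChainLaw p ε μ) : (⊥ : Fin K) < ⊤ := by
  have := hμ.two_le
  have : Nontrivial (Fin K) := Fin.nontrivial_iff_two_le.2 this
  exact _root_.bot_lt_top

theorem cdf_const_bot (hμ : IsChainLaw p ε μ) : cdf μ (fun _ => ⊥) = 0 := by
  rw [← hμ.measureReal_singleton fun _ => (⊥ : Fin K), cdf]
  congr 1
  ext w
  exact ⟨fun h => toLex.injective (le_antisymm h (lex_le_of_le fun i => (bot_le : ⊥ ≤ w i))),
    fun h => (congrArg toLex (mem_singleton_iff.1 h)).le⟩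

theorem cdf_const_top (hμ : IsChainLaw p ε μ) : cdf μ (fun _ => ⊤) = 1 := by
  have := hμ.isProb
  rw [← probReal_univ (μ := μ), cdf]
  congr 1
  ext w
  exact iff_true_intro (lex_le_of_le fun i => le_top)

/-- The two codes of a point of `h(𝒬)` have the same image. -/
theorem cdf_splice_eq (hμ : IsChainLaw p ε μ) {a a' : Fin K} (h : (a' : ℕ) = a + 1) (n : ℕ)
    (z : ℕ → Fin K) : cdf μ (splice n z a ⊤) = cdf μ (splice n z a' ⊥) := by
  have := hμ.isProb
  have hlt := splice_top_lex_lt_splice_bot (n := n) (z := z) h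
  have h1 := hμ.cdf_sub hlt.le
  have h2 : μ.real (lexIoc (splice n z a ⊤) (splice n z a' ⊥)) ≤ 0 := by
    rw [← hμ.measureReal_singleton (splice n z a' ⊥)]
    exact measureReal_mono fun w hw => eq_of_splice_top_lt_of_le_splice_bot h hw.1 hw.2
  exact le_antisymm (hμ.cdf_mono hlt.le) (by linarith)

/-- Only neighbours in the lexicographic order are identified by the distribution function. -/
theorem exists_splice_of_cdf_eq (hμ : IsChainLaw p ε μ) {x y : ℕ → Fin K}
    (h : toLex x < toLex y) (hc : cdf μ x = cdf μ y) :
    ∃ (n : ℕ) (z : ℕ → Fin K) (a a' : Fin K), (a' : ℕ) = a + 1 ∧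
      x = splice n z a ⊤ ∧ y = splice n z a' ⊥ := by
  obtain ⟨n, a', h1, -, ha', hx, hy⟩ := exists_splice_between h
  have hm := splice_top_lex_lt_splice_bot (n := n) (z := x) ha'
  have c1 := hμ.cdf_mono hx
  have c2 := hμ.cdf_mono hm.le
  have c3 := hμ.cdf_mono hy
  refine ⟨n, x, x n, a', ha', ?_, ?_⟩
  · rcases hx.eq_or_lt with h' | h'
    · exact toLex.injective h'
    · obtain ⟨m, -, -, hcyl⟩ := exists_cylinder_between_top (fun _ _ => rfl) h'
      have := hμ.pow_le_cdf_sub hcyl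
      have := pow_pos hμ.pos (m + 1)
      linarith
  · rcases hy.eq_or_lt with h' | h'
    · exact (toLex.injective h').symm
    · obtain ⟨m, -, -, hcyl⟩ := exists_cylinder_between_bot (fun i hi => (h1 i hi).symm) h'
      have := hμ.pow_le_cdf_sub' hcyl
      have := pow_pos hμ.pos (m + 1)
      linarith

/-- The distribution function is at most two-to-one. -/
theorem cdf_lt_of_cdf_eq (hμ : IsChainLaw p ε μ) {x y w : ℕ → Fin K} (h : toLex x < toLex y)
    (hc : cdf μ x = cdf μ y) (hw : toLex y < toLex w) : cdf μ y < cdf μ w := by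
  refine lt_of_le_of_ne (hμ.cdf_mono hw.le) fun hc' => ?_
  obtain ⟨n, z, a, a', -, -, h1⟩ := hμ.exists_splice_of_cdf_eq h hc
  obtain ⟨n', z', b, b', -, h2, -⟩ := hμ.exists_splice_of_cdf_eq hw hc'
  have := congrFun (h1.symm.trans h2) (n + n' + 1)
  rw [splice_of_gt (by omega), splice_of_gt (by omega)] at this
  exact hμ.bot_lt_top.ne this

theorem cdf_lt_cdf_splice_top (hμ : IsChainLaw p ε μ) {n : ℕ} {z w : ℕ → Fin K} {a a' : Fin K}
    (h : (a' : ℕ) = a + 1) (hw : toLex w < toLex (splice n z a ⊤)) :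
    cdf μ w < cdf μ (splice n z a ⊤) :=
  lt_of_le_of_ne (hμ.cdf_mono hw.le) fun hc =>
    (hμ.cdf_lt_of_cdf_eq hw hc (splice_top_lex_lt_splice_bot h)).ne (hμ.cdf_splice_eq h n z)

theorem cdf_splice_bot_lt_cdf (hμ : IsChainLaw p ε μ) {n : ℕ} {z w : ℕ → Fin K} {a a' : Fin K}
    (h : (a' : ℕ) = a + 1) (hw : toLex (splice n z a' ⊥) < toLex w) :
    cdf μ (splice n z a' ⊥) < cdf μ w :=
  hμ.cdf_lt_of_cdf_eq (splice_top_lex_lt_splice_bot h) (hμ.cdf_splice_eq h n z) hw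

/-- Points of `[0, 1]` can be enclosed in the images of arbitrarily long cylinders. -/
theorem exists_splice_bot_le_le_splice_top (hμ : IsChainLaw p ε μ) {t : ℝ}
    (ht : t ∈ Icc (0 : ℝ) 1) (n : ℕ) : ∃ (x : ℕ → Fin K) (a : Fin K),
      cdf μ (splice n x a ⊥) ≤ t ∧ t ≤ cdf μ (splice n x a ⊤) := by
  have key : ∀ (n : ℕ) (z : ℕ → Fin K), cdf μ (splice n z ⊥ ⊥) ≤ t →
      t ≤ cdf μ (splice n z ⊤ ⊤) → ∃ a : Fin K,
        cdf μ (splice n z a ⊥) ≤ t ∧ t ≤ cdf μ (splice n z a ⊤) := by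
    intro n z h1 h2
    classical
    have hne : (Finset.univ.filter fun a : Fin K => t ≤ cdf μ (splice n z a ⊤)).Nonempty :=
      ⟨⊤, by simpa using h2⟩
    obtain ⟨a, ha, hmin⟩ := Finset.exists_min_image _ id hne
    rw [Finset.mem_filter] at ha
    refine ⟨a, ?_, ha.2⟩
    rcases eq_or_ne a ⊥ with rfl | hbot
    · exact h1
    · have hpos : ((⊥ : Fin K) : ℕ) < a := Fin.lt_def.1 (bot_lt_iff_ne_bot.2 hbot)
      obtain ⟨b, hb⟩ : ∃ b : Fin K, (a : ℕ) = b + 1 :=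
        ⟨⟨a - 1, by omega⟩, by simp only; omega⟩
      rw [← hμ.cdf_splice_eq hb]
      by_contra hlt
      have : a ≤ b := hmin b (by simpa using (not_le.1 hlt).le)
      rw [Fin.le_def] at this
      omega
  induction n with
  | zero =>
    obtain ⟨a, ha⟩ := key 0 (fun _ => ⊥)
      ((hμ.cdf_const_bot.symm ▸ ht.1 : cdf μ (fun _ => ⊥) ≤ t).trans' (hμ.cdf_mono
        (lex_le_of_le fun i => by simp [splice])))
      ((hμ.cdf_const_top.symm ▸ ht.2 : t ≤ cdf μ (fun _ => ⊤)).trans (hμ.cdf_mono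
        (lex_le_of_le fun i => by simp [splice])))
    exact ⟨_, a, ha⟩
  | succ n ih =>
    obtain ⟨x, a, h1, h2⟩ := ih
    have hs : ∀ c : Fin K, splice (n + 1) (splice n x a ⊥) c c = splice n x a c := fun c => by
      funext i
      rcases lt_trichotomy i n with hi | rfl | hi
      · rw [splice_of_lt (by omega), splice_of_lt hi, splice_of_lt hi]
      · rw [splice_of_lt (by omega), splice_self, splice_self]
      · rw [splice_of_gt hi]
        rcases (Nat.succ_le_iff.2 hi).eq_or_lt with hi | hi
        · rw [← hi]; exact splice_self _ _ _ _
        · exact splice_of_gt hi _ _ _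
    obtain ⟨b, hb⟩ := key (n + 1) (splice n x a ⊥) (by rwa [hs]) (by rwa [hs])
    exact ⟨_, b, hb⟩

theorem exists_cdf_eq (hμ : IsChainLaw p ε μ) {t : ℝ} (ht : t ∈ Icc (0 : ℝ) 1) :
    ∃ x, cdf μ x = t := by
  have hcl : IsClosed (range (cdf μ)) := (isCompact_range hμ.continuous_cdf).isClosed
  rw [← mem_range, ← hcl.closure_eq]
  refine Metric.mem_closure_iff.2 fun δ hδ => ?_
  obtain ⟨n, hn⟩ := (hμ.tendsto_one_sub_pow.eventually (gt_mem_nhds hδ)).exists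
  obtain ⟨x, a, h1, h2⟩ := hμ.exists_splice_bot_le_le_splice_top ht n
  refine ⟨_, mem_range_self (splice n x a ⊥), ?_⟩
  have := hμ.abs_cdf_sub_le (x := splice n x a ⊥) (y := splice n x a ⊤) (n := n) fun i hi => by
    rw [splice_of_lt hi, splice_of_lt hi]
  rw [Real.dist_eq, abs_of_nonneg (by linarith)]
  linarith [le_abs_self (cdf μ (splice n x a ⊤) - cdf μ (splice n x a ⊥))]

/-- The distribution function transports `μ` to Lebesgue measure. -/
theorem measurePreserving_cdf (hμ : IsChainLaw p ε μ) :
    MeasurePreserving (cdf μ) μ (volume.restrict (Icc (0 : ℝ) 1)) := by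
  have := hμ.isProb
  refine ⟨hμ.continuous_cdf.measurable, ?_⟩
  refine (Measure.ext_of_Iic _ _ fun t => ?_)
  have hpre : μ (cdf μ ⁻¹' Iic t) = ENNReal.ofReal (μ.real {x | cdf μ x ≤ t}) :=
    (ofReal_measureReal).symm
  rw [Measure.map_apply hμ.continuous_cdf.measurable measurableSet_Iic, hpre,
    Measure.restrict_apply measurableSet_Iic]
  rcases lt_or_ge t 0 with h0 | h0
  · have h1 : {x | cdf μ x ≤ t} = ∅ := by
      ext x; simpa using h0.trans_le (hμ.cdf_mem_Icc x).1
    have h2 : Iic t ∩ Icc (0 : ℝ) 1 = ∅ := by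
      ext s; simp only [mem_inter_iff, mem_Iic, mem_Icc, mem_empty_iff_false, iff_false]
      intro h; linarith [h.1, h.2.1]
    simp [h1, h2]
  rcases lt_or_ge 1 t with h1 | h1
  · have h1' : {x | cdf μ x ≤ t} = univ := by
      ext x; simpa using (hμ.cdf_mem_Icc x).2.trans h1.le
    have h2 : Iic t ∩ Icc (0 : ℝ) 1 = Icc 0 1 :=
      inter_eq_right.2 fun s hs => hs.2.trans h1.le
    simp [h1', h2]
  obtain ⟨x, rfl⟩ := hμ.exists_cdf_eq ⟨h0, h1⟩
  have h2 : Iic (cdf μ x) ∩ Icc (0 : ℝ) 1 = Icc 0 (cdf μ x) := by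
    ext s; simp only [mem_inter_iff, mem_Iic, mem_Icc]
    exact ⟨fun h => ⟨h.2.1, h.1⟩, fun h => ⟨h.2, h.1, h.2.trans h1⟩⟩
  rw [h2, Real.volume_Icc, sub_zero]
  congr 1
  refine le_antisymm ?_ (measureReal_mono fun w hw => hμ.cdf_mono hw)
  -- at most one sequence above `x` has the same image as `x`
  have hsub : ({w | toLex x < toLex w ∧ cdf μ x = cdf μ w}).Subsingleton := by
    rintro v ⟨hv1, hv2⟩ w ⟨hw1, hw2⟩
    rcases lt_trichotomy (toLex v) (toLex w) with h | h | h
    · exact absurd (hv2.symm.trans hw2) (hμ.cdf_lt_of_cdf_eq hv1 hv2 h).ne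
    · exact toLex.injective h
    · exact absurd (hw2.symm.trans hv2) (hμ.cdf_lt_of_cdf_eq hw1 hw2 h).ne
  have hnull : μ.real {w | toLex x < toLex w ∧ cdf μ x = cdf μ w} = 0 := by
    rcases hsub.eq_empty_or_singleton with h | ⟨w, h⟩
    · rw [h, measureReal_empty]
    · rw [h, hμ.measureReal_singleton]
  have hincl : {w | cdf μ w ≤ cdf μ x} ⊆
      {w | toLex w ≤ toLex x} ∪ {w | toLex x < toLex w ∧ cdf μ x = cdf μ w} := fun w hw => by
    rcases le_or_gt (toLex w) (toLex x) with h | h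
    · exact Or.inl h
    · exact Or.inr ⟨h, le_antisymm (hμ.cdf_mono h.le) hw⟩
  refine (measureReal_mono hincl).trans ((measureReal_union_le _ _).trans ?_)
  rw [hnull, add_zero]
  exact le_rfl

end IsChainLaw

end InfChain

namespace InfChain

/-! ### The interval map -/

section IntervalMap

variable {K : ℕ} [NeZero K]

/-- A code of the point `ω` of `[0, 1]`. -/
noncomputable def decode (μ : Measure (ℕ → Fin K)) : ℝ → ℕ → Fin K := Function.invFun (cdf μ)

/-- The interval map: the shift read through the distribution function of `μ`. At a point with two
codes one of them is chosen, which matters only if the codes differ in the first symbol. -/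
noncomputable def intervalMap (μ : Measure (ℕ → Fin K)) (ω : ℝ) : ℝ := cdf μ (tail (decode μ ω))

/-- The end points of the intervals of the partition. -/
noncomputable def cutPt (μ : Measure (ℕ → Fin K)) : Fin (K + 1) → ℝ :=
  Fin.cons 0 (fun a : Fin K => cdf μ (cons a (fun _ => ⊤)))

end IntervalMap

namespace IsChainLaw

variable {K : ℕ} {p : Fin K → (ℕ → Fin K) → ℝ} {ε : ℝ} {μ : Measure (ℕ → Fin K)} [NeZero K]

theorem cdf_decode (hμ : IsChainLaw p ε μ) {ω : ℝ} (hω : ω ∈ Icc (0 : ℝ) 1) :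
    cdf μ (decode μ ω) = ω :=
  Function.invFun_eq (hμ.exists_cdf_eq hω)

theorem cdf_decode_cdf (hμ : IsChainLaw p ε μ) (x : ℕ → Fin K) :
    cdf μ (decode μ (cdf μ x)) = cdf μ x :=
  hμ.cdf_decode (hμ.cdf_mem_Icc x)

theorem cutPt_succ (μ : Measure (ℕ → Fin K)) (j : Fin K) :
    cutPt μ j.succ = cdf μ (cons j fun _ => ⊤) := rfl

theorem cdf_cons_top_eq (hμ : IsChainLaw p ε μ) {a a' : Fin K} (h : (a' : ℕ) = a + 1) :
    cdf μ (cons a fun _ => ⊤) = cdf μ (cons a' fun _ => ⊥) := by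
  have := hμ.cdf_splice_eq h 0 fun _ => ⊥
  rwa [splice_zero, splice_zero] at this

theorem cutPt_castSucc (hμ : IsChainLaw p ε μ) (j : Fin K) :
    cutPt μ j.castSucc = cdf μ (cons j fun _ => ⊥) := by
  rcases eq_or_ne (j : ℕ) 0 with h0 | h0
  · have hj : j = ⊥ := Fin.ext h0
    have h1 : j.castSucc = 0 := Fin.ext h0
    have h2 : cons j (fun _ => ⊥) = fun _ : ℕ => (⊥ : Fin K) := by
      funext i; cases i with
      | zero => exact hj
      | succ i => rfl
    rw [h1, h2, hμ.cdf_const_bot]; rfl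
  · obtain ⟨b, hb⟩ : ∃ b : Fin K, (j : ℕ) = b + 1 := ⟨⟨j - 1, by omega⟩, by simp only; omega⟩
    have h1 : j.castSucc = b.succ := Fin.ext (by simpa using hb)
    rw [h1, cutPt_succ, hμ.cdf_cons_top_eq hb]

theorem cutPt_lt (hμ : IsChainLaw p ε μ) (j : Fin K) : cutPt μ j.castSucc < cutPt μ j.succ := by
  rw [hμ.cutPt_castSucc, cutPt_succ]
  have h := hμ.mul_cdf_tail_sub_le (x := cons j fun _ => ⊥) (y := cons j fun _ => ⊤) rfl
    (cons_lex_le_cons.2 (lex_le_of_le fun _ => bot_le))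
  rw [tail_cons, tail_cons, hμ.cdf_const_bot, hμ.cdf_const_top] at h
  linarith [hμ.pos]

theorem strictMono_cutPt (hμ : IsChainLaw p ε μ) : StrictMono (cutPt μ) :=
  Fin.strictMono_iff_lt_succ.2 hμ.cutPt_lt

theorem cutPt_last (hμ : IsChainLaw p ε μ) : cutPt μ (Fin.last K) = 1 := by
  obtain ⟨n, rfl⟩ : ∃ n, K = n + 1 := ⟨K - 1, by have := hμ.two_le; omega⟩
  rw [← Fin.succ_last, cutPt_succ, ← hμ.cdf_const_top]
  congr 1
  funext i
  cases i <;> rfl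

theorem cutPt_mem_Icc (hμ : IsChainLaw p ε μ) (i : Fin (K + 1)) : cutPt μ i ∈ Icc (0 : ℝ) 1 := by
  refine ⟨?_, hμ.cutPt_last ▸ hμ.strictMono_cutPt.monotone (Fin.le_last i)⟩
  exact hμ.strictMono_cutPt.monotone (Fin.zero_le i)

theorem cdf_mem_closedPiece (hμ : IsChainLaw p ε μ) (x : ℕ → Fin K) :
    cdf μ x ∈ closedPiece (cutPt μ) (x 0) := by
  rw [closedPiece, hμ.cutPt_castSucc, cutPt_succ]
  have h1 := (cons_lex_le_cons (a := x 0)).2 (lex_le_of_le fun i => (bot_le : ⊥ ≤ tail x i))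
  have h2 := (cons_lex_le_cons (a := x 0)).2 (lex_le_of_le fun i => (le_top : tail x i ≤ ⊤))
  rw [cons_tail] at h1 h2
  exact ⟨hμ.cdf_mono h1, hμ.cdf_mono h2⟩

theorem zero_eq_of_cdf_mem_piece (hμ : IsChainLaw p ε μ) {x : ℕ → Fin K} {j : Fin K}
    (h : cdf μ x ∈ piece (cutPt μ) j) : x 0 = j := by
  rw [piece, hμ.cutPt_castSucc, cutPt_succ] at h
  exact le_antisymm (zero_le_of_lex_le (hμ.lex_lt_of_cdf_lt h.2).le)
    (zero_le_of_lex_le (hμ.lex_lt_of_cdf_lt h.1).le)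

theorem closedPiece_subset (hμ : IsChainLaw p ε μ) (j : Fin K) :
    closedPiece (cutPt μ) j ⊆ Icc 0 1 :=
  Icc_subset_Icc (hμ.cutPt_mem_Icc _).1 (hμ.cutPt_mem_Icc _).2

theorem piece_subset (hμ : IsChainLaw p ε μ) (j : Fin K) : piece (cutPt μ) j ⊆ Icc 0 1 :=
  Ioo_subset_Icc_self.trans (hμ.closedPiece_subset j)

theorem decode_zero (hμ : IsChainLaw p ε μ) {u : ℝ} {j : Fin K} (h : u ∈ piece (cutPt μ) j) :
    decode μ u 0 = j :=
  hμ.zero_eq_of_cdf_mem_piece (by rwa [hμ.cdf_decode (hμ.piece_subset j h)])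

theorem mem_piece_or_mem_range (hμ : IsChainLaw p ε μ) (x : ℕ → Fin K) :
    cdf μ x ∈ piece (cutPt μ) (x 0) ∨ cdf μ x ∈ range (cutPt μ) := by
  obtain ⟨h1, h2⟩ := hμ.cdf_mem_closedPiece x
  rcases h1.eq_or_lt with h1 | h1
  · exact Or.inr ⟨_, h1⟩
  rcases h2.eq_or_lt with h2 | h2
  · exact Or.inr ⟨_, h2.symm⟩
  exact Or.inl ⟨h1, h2⟩

/-- On the interior of an interval of the partition the interval map is conjugate to the shift,
whichever code is used. -/
theorem intervalMap_cdf (hμ : IsChainLaw p ε μ) {x : ℕ → Fin K} {j : Fin K}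
    (h : cdf μ x ∈ piece (cutPt μ) j) : intervalMap μ (cdf μ x) = cdf μ (tail x) :=
  (hμ.cdf_tail_eq_iff ((hμ.decode_zero h).trans (hμ.zero_eq_of_cdf_mem_piece h).symm)).2
    (hμ.cdf_decode_cdf x)

theorem intervalMap_mem_Icc (hμ : IsChainLaw p ε μ) (ω : ℝ) : intervalMap μ ω ∈ Icc (0 : ℝ) 1 :=
  hμ.cdf_mem_Icc _

theorem strictMonoOn_intervalMap (hμ : IsChainLaw p ε μ) (j : Fin K) :
    StrictMonoOn (intervalMap μ) (piece (cutPt μ) j) := by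
  intro u hu v hv huv
  have hu' := hμ.cdf_decode (hμ.piece_subset j hu)
  have hv' := hμ.cdf_decode (hμ.piece_subset j hv)
  have h0 : decode μ u 0 = decode μ v 0 := (hμ.decode_zero hu).trans (hμ.decode_zero hv).symm
  have hlt : cdf μ (decode μ u) < cdf μ (decode μ v) := by rwa [hu', hv']
  exact lt_of_le_of_ne
    (hμ.cdf_mono ((tail_lex_lt_tail h0).2 (hμ.lex_lt_of_cdf_lt hlt)).le)
    fun h => hlt.ne ((hμ.cdf_tail_eq_iff h0).1 h)

theorem abs_intervalMap_sub_le (hμ : IsChainLaw p ε μ) {j : Fin K} {u v : ℝ}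
    (hu : u ∈ piece (cutPt μ) j) (hv : v ∈ piece (cutPt μ) j) :
    |intervalMap μ v - intervalMap μ u| ≤ ε⁻¹ * |v - u| := by
  have h := hμ.abs_cdf_tail_sub_le ((hμ.decode_zero hu).trans (hμ.decode_zero hv).symm)
  rwa [hμ.cdf_decode (hμ.piece_subset j hu), hμ.cdf_decode (hμ.piece_subset j hv)] at h

theorem continuousOn_intervalMap (hμ : IsChainLaw p ε μ) (j : Fin K) :
    ContinuousOn (intervalMap μ) (piece (cutPt μ) j) := by
  refine LipschitzOnWith.continuousOn (K := (ε⁻¹).toNNReal) ?_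
  refine LipschitzOnWith.of_dist_le_mul fun u hu v hv => ?_
  rw [Real.coe_toNNReal _ (inv_nonneg.2 hμ.pos.le), Real.dist_eq, Real.dist_eq]
  exact hμ.abs_intervalMap_sub_le hv hu

theorem measurable_intervalMap (hμ : IsChainLaw p ε μ) : Measurable (intervalMap μ) := by
  refine measurable_of_Iic fun t => ?_
  have hcover : intervalMap μ ⁻¹' Iic t =
      (⋃ j, piece (cutPt μ) j ∩ intervalMap μ ⁻¹' Iic t) ∪
        (range (cutPt μ) ∩ intervalMap μ ⁻¹' Iic t) ∪
        ((Icc 0 1)ᶜ ∩ intervalMap μ ⁻¹' Iic t) := by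
    rw [← iUnion_inter, ← union_inter_distrib_right, ← union_inter_distrib_right]
    refine (inter_eq_right.2 fun u _ => ?_).symm
    by_cases hu : u ∈ Icc (0 : ℝ) 1
    · refine Or.inl ?_
      rw [← hμ.cdf_decode hu]
      exact (hμ.mem_piece_or_mem_range _).imp (fun h => mem_iUnion.2 ⟨_, h⟩) id
    · exact Or.inr hu
  rw [hcover]
  refine ((MeasurableSet.iUnion fun j => ?_).union ?_).union ?_
  · refine OrdConnected.measurableSet ⟨fun u hu v hv w hw => ?_⟩
    have hw' : w ∈ piece (cutPt μ) j := ⟨hu.1.1.trans_le hw.1, hw.2.trans_lt hv.1.2⟩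
    exact ⟨hw', ((hμ.strictMonoOn_intervalMap j).monotoneOn hw' hv.1 hw.2).trans hv.2⟩
  · exact ((finite_range _).subset inter_subset_left).measurableSet
  -- outside `[0, 1]` the map is constant
  · have hconst : ∀ u ∈ (Icc (0 : ℝ) 1)ᶜ, intervalMap μ u = intervalMap μ 2 := by
      have h : ∀ u ∈ (Icc (0 : ℝ) 1)ᶜ, decode μ u = Classical.choice inferInstance :=
        fun u hu => Function.invFun_neg fun ⟨x, hx⟩ => hu (hx ▸ hμ.cdf_mem_Icc x)
      intro u hu
      rw [intervalMap, intervalMap, h u hu, h 2 (by simp)]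
    by_cases h : intervalMap μ 2 ≤ t
    · convert (measurableSet_Icc (a := (0 : ℝ)) (b := 1)).compl using 1
      exact inter_eq_left.2 fun u hu => (hconst u hu).trans_le h
    · convert MeasurableSet.empty using 1
      exact eq_empty_of_forall_notMem fun u hu => h ((hconst u hu.1).symm.trans_le hu.2)

/-- All branches of the interval map are full. -/
theorem isTopologicalMarkov (hμ : IsChainLaw p ε μ) :
    IsTopologicalMarkov (intervalMap μ) (cutPt μ) := by
  intro i
  refine ⟨univ, ?_⟩
  have h1 : ⋃ j ∈ (univ : Set (Fin K)), closure (piece (cutPt μ) j) = Icc 0 1 := by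
    refine Subset.antisymm (iUnion₂_subset fun j _ => ?_) fun u hu => ?_
    · exact closure_minimal (hμ.piece_subset j) isClosed_Icc
    · refine mem_iUnion₂.2 ⟨decode μ u 0, trivial, ?_⟩
      rw [piece, closure_Ioo (hμ.cutPt_lt _).ne]
      have := hμ.cdf_mem_closedPiece (decode μ u)
      rwa [hμ.cdf_decode hu] at this
  rw [h1]
  refine Subset.antisymm (closure_minimal ?_ isClosed_Icc) ?_
  · rintro _ ⟨u, -, rfl⟩
    exact hμ.intervalMap_mem_Icc u
  · rw [← closure_Ioo zero_ne_one]
    refine closure_mono fun t ht => ?_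
    obtain ⟨y, rfl⟩ := hμ.exists_cdf_eq (Ioo_subset_Icc_self ht)
    have hmem : cdf μ (cons i y) ∈ piece (cutPt μ) i := by
      obtain ⟨g1, g2⟩ := hμ.cdf_mem_closedPiece (cons i y)
      rw [cons_zero] at g1 g2
      refine ⟨lt_of_le_of_ne g1 fun h => ?_, lt_of_le_of_ne g2 fun h => ?_⟩
      · rw [hμ.cutPt_castSucc, ← hμ.cdf_tail_eq_iff (by simp), tail_cons, tail_cons,
          hμ.cdf_const_bot] at h
        exact ht.1.ne h
      · rw [cutPt_succ, ← hμ.cdf_tail_eq_iff (by simp), tail_cons, tail_cons, hμ.cdf_const_top] at h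
        exact ht.2.ne h
    exact ⟨_, hmem, by rw [hμ.intervalMap_cdf hmem, tail_cons]⟩

/-! ### Invariance, ergodicity and the coding -/

theorem ae_cdf_mem_piece (hμ : IsChainLaw p ε μ) :
    ∀ᵐ x ∂μ, cdf μ x ∈ piece (cutPt μ) (x 0) := by
  have h : ∀ᵐ u ∂(volume.restrict (Icc (0 : ℝ) 1)), u ∉ range (cutPt μ) :=
    measure_eq_zero_iff_ae_notMem.1 ((finite_range _).measure_zero _)
  filter_upwards [hμ.measurePreserving_cdf.quasiMeasurePreserving.ae h] with x hx
  exact (hμ.mem_piece_or_mem_range x).resolve_right hx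

theorem ae_intervalMap_cdf (hμ : IsChainLaw p ε μ) :
    ∀ᵐ x ∂μ, intervalMap μ (cdf μ x) = cdf μ (tail x) := by
  filter_upwards [hμ.ae_cdf_mem_piece] with x hx using hμ.intervalMap_cdf hx

theorem measurePreserving_intervalMap (hμ : IsChainLaw p ε μ) (ht : MeasurePreserving tail μ μ) :
    MeasurePreserving (intervalMap μ) (volume.restrict (Icc (0 : ℝ) 1))
      (volume.restrict (Icc (0 : ℝ) 1)) := by
  refine ⟨hμ.measurable_intervalMap, ?_⟩
  have h := hμ.measurePreserving_cdf
  calc Measure.map (intervalMap μ) (volume.restrict (Icc (0 : ℝ) 1))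
      = Measure.map (intervalMap μ ∘ cdf μ) μ := by
        rw [← Measure.map_map hμ.measurable_intervalMap h.measurable, h.map_eq]
    _ = Measure.map (cdf μ ∘ tail) μ := Measure.map_congr hμ.ae_intervalMap_cdf
    _ = _ := (h.comp ht).map_eq

theorem ergodic_intervalMap (hμ : IsChainLaw p ε μ) (ht : Ergodic tail μ) :
    Ergodic (intervalMap μ) (volume.restrict (Icc (0 : ℝ) 1)) := by
  refine ⟨hμ.measurePreserving_intervalMap ht.toMeasurePreserving, ⟨fun s hs hinv => ?_⟩⟩
  have h := hμ.measurePreserving_cdf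
  rw [← h.aeconst_preimage hs.nullMeasurableSet]
  refine ht.quasiErgodic.aeconst_set₀ (h.measurable hs).nullMeasurableSet ?_
  filter_upwards [hμ.ae_intervalMap_cdf] with x hx
  refine propext ?_
  change cdf μ (tail x) ∈ s ↔ cdf μ x ∈ s
  rw [← hx, ← mem_preimage, hinv]

/-- Almost surely the orbit of `h(x)` visits the interiors of the intervals indexed by the
symbols of `x`. -/
theorem ae_iterate_mem_piece (hμ : IsChainLaw p ε μ) (ht : MeasurePreserving tail μ μ) :
    ∀ᵐ x ∂μ, ∀ n, (intervalMap μ)^[n] (cdf μ x) ∈ piece (cutPt μ) (x n) := by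
  have h : ∀ᵐ x ∂μ, ∀ n, cdf μ (tail^[n] x) ∈ piece (cutPt μ) (x n) := by
    refine ae_all_iff.2 fun n => ?_
    filter_upwards [(ht.iterate n).quasiMeasurePreserving.ae hμ.ae_cdf_mem_piece] with x hx
    rwa [tail_iterate_zero] at hx
  filter_upwards [h] with x hx
  have key : ∀ n, (intervalMap μ)^[n] (cdf μ x) = cdf μ (tail^[n] x) := by
    intro n
    induction n with
    | zero => rfl
    | succ n ih =>
      rw [Function.iterate_succ_apply', ih, hμ.intervalMap_cdf (hx n),
        Function.iterate_succ_apply']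
  intro n
  rw [key]
  exact hx n

theorem eq_of_mem_piece (hμ : IsChainLaw p ε μ) {u : ℝ} {i j : Fin K}
    (hi : u ∈ piece (cutPt μ) i) (hj : u ∈ piece (cutPt μ) j) : i = j :=
  (hμ.decode_zero hi).symm.trans (hμ.decode_zero hj)

theorem code_eq_iff (hμ : IsChainLaw p ε μ) {u : ℝ} {n : ℕ} {j : Fin K} :
    code (intervalMap μ) (cutPt μ) u n = j ↔ (intervalMap μ)^[n] u ∈ piece (cutPt μ) j ∨
      ((∀ i, (intervalMap μ)^[n] u ∉ piece (cutPt μ) i) ∧ j = ⊥) := by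
  unfold code
  split_ifs with h
  · refine ⟨fun hc => Or.inl (hc ▸ h.choose_spec), fun hc => ?_⟩
    rcases hc with hc | hc
    · exact hμ.eq_of_mem_piece h.choose_spec hc
    · exact absurd h (not_exists.2 hc.1)
  · exact ⟨fun hc => Or.inr ⟨not_exists.1 h, hc.symm⟩, fun hc =>
      (hc.resolve_left fun h' => h ⟨j, h'⟩).2.symm⟩

theorem measurable_code (hμ : IsChainLaw p ε μ) :
    Measurable (code (intervalMap μ) (cutPt μ)) := by
  refine measurable_pi_lambda _ fun n => measurable_to_countable' fun j => ?_
  have hm : ∀ i, MeasurableSet {u | (intervalMap μ)^[n] u ∈ piece (cutPt μ) i} := fun i =>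
    (hμ.measurable_intervalMap.iterate n) measurableSet_Ioo
  have : (fun u => code (intervalMap μ) (cutPt μ) u n) ⁻¹' {j} =
      {u | (intervalMap μ)^[n] u ∈ piece (cutPt μ) j} ∪
        ((⋂ i, {u | (intervalMap μ)^[n] u ∈ piece (cutPt μ) i}ᶜ) ∩ {_u | j = ⊥}) := by
    ext u
    simp [hμ.code_eq_iff]
  rw [this]
  exact (hm j).union ((MeasurableSet.iInter fun i => (hm i).compl).inter (.const _))

theorem ae_code_cdf (hμ : IsChainLaw p ε μ) (ht : MeasurePreserving tail μ μ) :
    ∀ᵐ x ∂μ, code (intervalMap μ) (cutPt μ) (cdf μ x) = x := by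
  filter_upwards [hμ.ae_iterate_mem_piece ht] with x hx
  exact funext fun n => hμ.code_eq_iff.2 (Or.inl (hx n))

theorem volume_real_dynCylinder (hμ : IsChainLaw p ε μ) (ht : MeasurePreserving tail μ μ)
    (y : ℕ → Fin K) (k : ℕ) :
    volume.real (dynCylinder (intervalMap μ) (cutPt μ) y k) = μ.real (cylinder y k) := by
  have hmeas : MeasurableSet (dynCylinder (intervalMap μ) (cutPt μ) y k) := by
    have : dynCylinder (intervalMap μ) (cutPt μ) y k =
        Icc 0 1 ∩ ⋂ j ∈ Finset.range k, (intervalMap μ)^[j] ⁻¹' piece (cutPt μ) (y j) := by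
      ext u; simp [dynCylinder]
    rw [this]
    exact measurableSet_Icc.inter (Finset.measurableSet_biInter _ fun j _ =>
      (hμ.measurable_intervalMap.iterate j) measurableSet_Ioo)
  rw [measureReal_def, measureReal_def,
    ← Measure.restrict_eq_self volume (s := dynCylinder (intervalMap μ) (cutPt μ) y k)
      (t := Icc (0 : ℝ) 1) fun u hu => hu.1,
    ← hμ.measurePreserving_cdf.measure_preimage hmeas.nullMeasurableSet]
  congr 1
  refine measure_congr ?_
  filter_upwards [hμ.ae_iterate_mem_piece ht] with x hx
  refine propext ⟨fun h j hj => hμ.eq_of_mem_piece (hx j) (h.2 j hj), fun h => ?_⟩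
  exact ⟨hμ.cdf_mem_Icc x, fun j hj => (h j hj) ▸ hx j⟩

theorem tendsto_volume_dynCylinder_div (hμ : IsChainLaw p ε μ) (ht : MeasurePreserving tail μ μ)
    (x : ℕ → Fin K) :
    Tendsto (fun k => volume.real (dynCylinder (intervalMap μ) (cutPt μ) x (k + 1)) /
        volume.real (dynCylinder (intervalMap μ) (cutPt μ) (tail x) k))
      atTop (𝓝 (p (x 0) (tail x))) := by
  have := hμ.isProb
  simp only [hμ.volume_real_dynCylinder ht]
  refine Metric.tendsto_atTop.2 fun δ hδ => ?_
  obtain ⟨n, hn⟩ := hμ.unif (δ / 2) (half_pos hδ)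
  refine ⟨n, fun k hk => ?_⟩
  have hpos : 0 < μ.real (cylinder (tail x) k) :=
    (pow_pos hμ.pos k).trans_le (hμ.pow_le_measureReal_cylinder _ _)
  rw [Real.dist_eq, cylinder_succ,
    hμ.step _ _ (isClopen_cylinder _ _).isOpen.measurableSet, div_sub' hpos.ne',
    abs_div, abs_of_pos hpos, div_lt_iff₀ hpos]
  have : ∫ w in cylinder (tail x) k, (p (x 0) w - p (x 0) (tail x)) ∂μ =
      (∫ w in cylinder (tail x) k, p (x 0) w ∂μ) -
        μ.real (cylinder (tail x) k) * p (x 0) (tail x) := by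
    rw [integral_sub (hμ.integrable _).integrableOn (integrable_const _).integrableOn,
      setIntegral_const, smul_eq_mul]
  rw [← this]
  refine (norm_setIntegral_le_of_norm_le_const
    (f := fun w => p (x 0) w - p (x 0) (tail x)) (measure_lt_top μ (cylinder (tail x) k))
    fun w hw => hn _ _ _ fun i hi => hw i (by omega)).trans_lt ?_
  exact mul_lt_mul_of_pos_right (half_lt_self hδ) hpos

/-- The symbol at time `0` given the symbols at times `1, 2, …` of the coding has the
transition probability `p`. -/
theorem condExp_indicator_piece (hμ : IsChainLaw p ε μ) (ht : MeasurePreserving tail μ μ)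
    (a : Fin K) :
    (volume.restrict (Icc (0 : ℝ) 1))[(piece (cutPt μ) a).indicator (fun _ => (1 : ℝ)) |
        MeasurableSpace.comap (fun ω => tail (code (intervalMap μ) (cutPt μ) ω)) inferInstance]
      =ᵐ[volume.restrict (Icc (0 : ℝ) 1)]
        fun ω => p a (tail (code (intervalMap μ) (cutPt μ) ω)) := by
  have := hμ.isProb
  have hg : Measurable fun ω => tail (code (intervalMap μ) (cutPt μ) ω) :=
    measurable_tail.comp hμ.measurable_code
  have hpiece : MeasurableSet (piece (cutPt μ) a) := measurableSet_Ioo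
  have hpg := (hμ.measurable a).comp hg
  have hint : Integrable (fun ω => p a (tail (code (intervalMap μ) (cutPt μ) ω)))
      (volume.restrict (Icc (0 : ℝ) 1)) := by
    refine Integrable.of_bound hpg.aestronglyMeasurable 1 (ae_of_all _ fun y => ?_)
    rw [Real.norm_eq_abs, abs_of_pos (hμ.prob_pos a _)]
    exact (hμ.prob_lt_one a _).le
  refine (ae_eq_condExp_of_forall_setIntegral_eq hg.comap_le
    ((integrable_const _).indicator hpiece) (fun _ _ _ => hint.integrableOn) ?_ ?_).symm
  · rintro _ ⟨B, hB, rfl⟩ -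
    have hc := hμ.measurePreserving_cdf
    have h1 : ∫ ω in (fun ω => tail (code (intervalMap μ) (cutPt μ) ω)) ⁻¹' B,
        p a (tail (code (intervalMap μ) (cutPt μ) ω)) ∂(volume.restrict (Icc (0 : ℝ) 1)) =
        ∫ y in B, p a y ∂μ := by
      have hBt : Measure.map (fun ω => tail (code (intervalMap μ) (cutPt μ) ω))
          (volume.restrict (Icc (0 : ℝ) 1)) = μ := by
        rw [← hc.map_eq, Measure.map_map hg hc.measurable]
        refine (Measure.map_congr ?_).trans ht.map_eq
        filter_upwards [hμ.ae_code_cdf ht] with x hx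
        simp only [Function.comp_apply, hx]
      conv_rhs => rw [← hBt]
      rw [setIntegral_map hB (hμ.measurable a).aestronglyMeasurable hg.aemeasurable]
    rw [h1, setIntegral_indicator hpiece, setIntegral_const, smul_eq_mul, mul_one, ← hμ.step a B hB,
      measureReal_def, measureReal_def,
      ← hc.measure_preimage ((hg hB).inter hpiece).nullMeasurableSet]
    congr 1
    refine measure_congr ?_
    filter_upwards [hμ.ae_code_cdf ht, hμ.ae_cdf_mem_piece] with x hx hx0
    refine propext ?_
    change (x 0 = a ∧ tail x ∈ B) ↔
      (tail (code (intervalMap μ) (cutPt μ) (cdf μ x)) ∈ B ∧ cdf μ x ∈ piece (cutPt μ) a)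
    rw [hx]
    exact ⟨fun h => ⟨h.2, h.1 ▸ hx0⟩, fun h => ⟨hμ.eq_of_mem_piece hx0 h.2, h.1⟩⟩
  · exact ((hμ.measurable a).comp (comap_measurable _)).stronglyMeasurable.aestronglyMeasurable

end IsChainLaw

end InfChain

namespace InfChain

/-! ### Derivatives of the interval map -/

namespace IsChainLaw

variable {K : ℕ} {p : Fin K → (ℕ → Fin K) → ℝ} {ε : ℝ} {μ : Measure (ℕ → Fin K)}

/-- The slope of the conjugated shift along a family of codes tends to `1 / d` as soon as the
transition probabilities on the pasts in between tend to `d`. -/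
theorem tendsto_slope_of_prob (hμ : IsChainLaw p ε μ) {α : Type*} {l : Filter α}
    {f : α → ℕ → Fin K} {x : ℕ → Fin K} {d : ℝ} (hd : d ≠ 0)
    (hne : ∀ᶠ u in l, cdf μ (f u) ≠ cdf μ x) (h0 : ∀ᶠ u in l, x 0 = f u 0)
    (h : ∀ δ > 0, ∀ᶠ u in l, ∀ w ∈ lexIoc (tail x) (tail (f u)) ∪ lexIoc (tail (f u)) (tail x),
      |p (x 0) w - d| ≤ δ) :
    Tendsto (fun u => (cdf μ (tail (f u)) - cdf μ (tail x)) / (cdf μ (f u) - cdf μ x)) l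
      (𝓝 (1 / d)) := by
  have key : Tendsto (fun u => (cdf μ (f u) - cdf μ x) / (cdf μ (tail (f u)) - cdf μ (tail x))) l
      (𝓝 d) := by
    refine Metric.tendsto_nhds.2 fun δ hδ => ?_
    filter_upwards [hne, h0, h (δ / 2) (half_pos hδ)] with u hu hu0 hu1
    have hpos : 0 < |cdf μ (tail (f u)) - cdf μ (tail x)| := by
      refine abs_pos.2 (sub_ne_zero.2 fun hc => hu ?_)
      exact (hμ.cdf_tail_eq_iff hu0.symm).1 hc
    rw [Real.dist_eq, div_sub' (abs_pos.1 hpos), abs_div, div_lt_iff₀ hpos, mul_comm _ d]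
    exact (hμ.abs_cdf_sub_sub_mul_le hu0 hu1).trans_lt
      (mul_lt_mul_of_pos_right (half_lt_self hδ) hpos)
  rw [one_div]
  refine (key.inv₀ hd).congr fun u => ?_
  rw [inv_div]

theorem tendsto_slope_of_cylinder (hμ : IsChainLaw p ε μ) {α : Type*} {l : Filter α}
    {f : α → ℕ → Fin K} {x : ℕ → Fin K} (hne : ∀ᶠ u in l, cdf μ (f u) ≠ cdf μ x)
    (h : ∀ n, ∀ᶠ u in l, f u ∈ cylinder x n) :
    Tendsto (fun u => (cdf μ (tail (f u)) - cdf μ (tail x)) / (cdf μ (f u) - cdf μ x)) l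
      (𝓝 (1 / p (x 0) (tail x))) := by
  refine hμ.tendsto_slope_of_prob (hμ.prob_pos _ _).ne' hne ?_ fun δ hδ => ?_
  · filter_upwards [h 1] with u hu using (hu 0 one_pos).symm
  · obtain ⟨n, hn⟩ := hμ.unif δ hδ
    filter_upwards [h (n + 1)] with u hu w hw
    have hag : ∀ i < n, tail (f u) i = tail x i := fun i hi => hu (i + 1) (by omega)
    refine hn _ _ _ ?_
    rcases hw with hw | hw
    · exact agree_of_between hw.1.le hw.2 fun i hi => (hag i hi).symm
    · exact fun i hi => (agree_of_between hw.1.le hw.2 hag i hi).trans (hag i hi)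

/-- Codes of points near `h(x)` avoid any closed set that contains no code of `h(x)`. -/
theorem eventually_forall_notMem (hμ : IsChainLaw p ε μ) {x : ℕ → Fin K} {D : Set (ℕ → Fin K)}
    (hD : IsClosed D) (h : ∀ y ∈ D, cdf μ y ≠ cdf μ x) :
    ∀ᶠ u in 𝓝 (cdf μ x), ∀ y, cdf μ y = u → y ∉ D := by
  have hcl : IsClosed (cdf μ '' D) := (hD.isCompact.image hμ.continuous_cdf).isClosed
  have hmem : cdf μ x ∉ cdf μ '' D := fun ⟨y, hy, hyx⟩ => h y hy hyx
  filter_upwards [hcl.isOpen_compl.mem_nhds hmem] with u hu y hy hyD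
  exact hu ⟨y, hyD, hy⟩

variable [NeZero K]

/-- Codes of points just to the left of the smallest code of a point are close to that code. -/
theorem eventually_decode_mem_cylinder_left (hμ : IsChainLaw p ε μ) {x : ℕ → Fin K}
    (hx : ∀ w, toLex w < toLex x → cdf μ w < cdf μ x) (h0 : 0 < cdf μ x) (n : ℕ) :
    ∀ᶠ u in 𝓝[<] cdf μ x, decode μ u ∈ cylinder x n := by
  have h := hμ.eventually_forall_notMem (x := x)
    ((isClosed_lex_le x).inter (isClopen_cylinder x n).compl.isClosed) fun y hy => by
      refine (hx y (lt_of_le_of_ne hy.1 fun hc => hy.2 ?_)).ne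
      rw [toLex.injective hc]
      exact fun _ _ => rfl
  filter_upwards [nhdsWithin_le_nhds h, nhdsWithin_le_nhds (lt_mem_nhds h0),
    self_mem_nhdsWithin] with u hu hu0 hux
  have hdec : cdf μ (decode μ u) = u :=
    hμ.cdf_decode ⟨le_of_lt hu0, (le_of_lt hux).trans (hμ.cdf_mem_Icc x).2⟩
  by_contra hc
  refine hu _ hdec ⟨(hμ.lex_lt_of_cdf_lt ?_).le, hc⟩
  rw [hdec]
  exact hux

theorem eventually_decode_mem_cylinder_right (hμ : IsChainLaw p ε μ) {x : ℕ → Fin K}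
    (hx : ∀ w, toLex x < toLex w → cdf μ x < cdf μ w) (h1 : cdf μ x < 1) (n : ℕ) :
    ∀ᶠ u in 𝓝[>] cdf μ x, decode μ u ∈ cylinder x n := by
  have h := hμ.eventually_forall_notMem (x := x)
    ((isClosed_lex_ge x).inter (isClopen_cylinder x n).compl.isClosed) fun y hy => by
      refine (hx y (lt_of_le_of_ne hy.1 fun hc => hy.2 ?_)).ne'
      rw [← toLex.injective hc]
      exact fun _ _ => rfl
  filter_upwards [nhdsWithin_le_nhds h, nhdsWithin_le_nhds (gt_mem_nhds h1),
    self_mem_nhdsWithin] with u hu hu1 hux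
  have hdec : cdf μ (decode μ u) = u :=
    hμ.cdf_decode ⟨(hμ.cdf_mem_Icc x).1.trans (le_of_lt hux), le_of_lt hu1⟩
  by_contra hc
  refine hu _ hdec ⟨(hμ.lex_lt_of_cdf_lt ?_).le, hc⟩
  rw [hdec]
  exact hux

/-- The one-sided limit and slope of the interval map at `h(x)`, from a side on which the codes
of nearby points converge to `x`. -/
theorem tendsto_intervalMap_of_cylinder (hμ : IsChainLaw p ε μ) {x : ℕ → Fin K} {l : Filter ℝ}
    (hl : l ≤ 𝓝 (cdf μ x)) (hmem : ∀ᶠ u in l, u ∈ Icc (0 : ℝ) 1) (hne : ∀ᶠ u in l, u ≠ cdf μ x)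
    (h : ∀ n, ∀ᶠ u in l, decode μ u ∈ cylinder x n) :
    Tendsto (intervalMap μ) l (𝓝 (cdf μ (tail x))) ∧
      Tendsto (fun u => (intervalMap μ u - cdf μ (tail x)) / (u - cdf μ x)) l
        (𝓝 (1 / p (x 0) (tail x))) := by
  have h2 : Tendsto (fun u => (intervalMap μ u - cdf μ (tail x)) / (u - cdf μ x)) l
      (𝓝 (1 / p (x 0) (tail x))) := by
    refine (hμ.tendsto_slope_of_cylinder (f := decode μ) ?_ h).congr' ?_
    · filter_upwards [hmem, hne] with u hu hu'
      rwa [hμ.cdf_decode hu]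
    · filter_upwards [hmem] with u hu
      rw [hμ.cdf_decode hu, intervalMap]
  refine ⟨?_, h2⟩
  have h3 : Tendsto (fun u => u - cdf μ x) l (𝓝 0) := by
    rw [← sub_self (cdf μ x)]
    exact (tendsto_id.mono_left hl).sub_const _
  have h4 := (h2.mul h3).add_const (cdf μ (tail x))
  rw [mul_zero, zero_add] at h4
  refine h4.congr' ?_
  filter_upwards [hne] with u hu
  rw [div_mul_cancel₀ _ (sub_ne_zero.2 hu), sub_add_cancel]

theorem cdf_splice_mem_Ioo (hμ : IsChainLaw p ε μ) {a a' : Fin K} (h : (a' : ℕ) = a + 1) (n : ℕ)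
    (z : ℕ → Fin K) : cdf μ (splice n z a ⊤) ∈ Ioo (0 : ℝ) 1 := by
  constructor
  · refine (hμ.cdf_mem_Icc fun _ => ⊥).1.trans_lt (hμ.cdf_lt_cdf_splice_top h ?_)
    refine lt_of_le_of_ne (lex_le_of_le fun _ => bot_le) fun hc => ?_
    have := congrFun (toLex.injective hc) (n + 1)
    rw [splice_of_gt n.lt_succ_self] at this
    exact hμ.bot_lt_top.ne this
  · rw [hμ.cdf_splice_eq h]
    refine (hμ.cdf_splice_bot_lt_cdf h (w := fun _ => ⊤) ?_).trans_le (hμ.cdf_mem_Icc _).2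
    refine lt_of_le_of_ne (lex_le_of_le fun _ => le_top) fun hc => ?_
    have := congrFun (toLex.injective hc) (n + 1)
    rw [splice_of_gt n.lt_succ_self] at this
    exact hμ.bot_lt_top.ne this

theorem hasLeftDeriv_intervalMap (hμ : IsChainLaw p ε μ) {a a' : Fin K} (h : (a' : ℕ) = a + 1)
    (n : ℕ) (z : ℕ → Fin K) :
    HasLeftDeriv (intervalMap μ) (1 / p (splice n z a ⊤ 0) (tail (splice n z a ⊤)))
      (cdf μ (splice n z a ⊤)) := by
  have hI := hμ.cdf_splice_mem_Ioo h n z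
  refine ⟨_, hμ.tendsto_intervalMap_of_cylinder nhdsWithin_le_nhds ?_ ?_
    (hμ.eventually_decode_mem_cylinder_left (fun w hw => hμ.cdf_lt_cdf_splice_top h hw) hI.1)⟩
  · exact nhdsWithin_le_nhds (Icc_mem_nhds hI.1 hI.2)
  · filter_upwards [self_mem_nhdsWithin] with u hu using ne_of_lt hu

theorem hasRightDeriv_intervalMap (hμ : IsChainLaw p ε μ) {a a' : Fin K} (h : (a' : ℕ) = a + 1)
    (n : ℕ) (z : ℕ → Fin K) :
    HasRightDeriv (intervalMap μ) (1 / p (splice n z a' ⊥ 0) (tail (splice n z a' ⊥)))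
      (cdf μ (splice n z a ⊤)) := by
  have hI := hμ.cdf_splice_mem_Ioo h n z
  rw [hμ.cdf_splice_eq h] at hI ⊢
  refine ⟨_, hμ.tendsto_intervalMap_of_cylinder nhdsWithin_le_nhds ?_ ?_
    (hμ.eventually_decode_mem_cylinder_right (fun w hw => hμ.cdf_splice_bot_lt_cdf h hw) hI.2)⟩
  · exact nhdsWithin_le_nhds (Icc_mem_nhds hI.1 hI.2)
  · filter_upwards [self_mem_nhdsWithin] with u hu using ne_of_gt hu

/-- Sequences that do not code a point of `h(𝒬)` are determined by their image. -/
theorem eq_of_cdf_eq (hμ : IsChainLaw p ε μ) {x y : ℕ → Fin K}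
    (hx : cdf μ x ∉ cdf μ '' exceptional K) (h : cdf μ x = cdf μ y) : x = y := by
  rcases lt_trichotomy (toLex x) (toLex y) with hlt | heq | hlt
  · obtain ⟨n, z, a, a', ha, h1, -⟩ := hμ.exists_splice_of_cdf_eq hlt h
    exact absurd ⟨x, ⟨n, z, a, a', ha, Or.inl h1⟩, rfl⟩ hx
  · exact toLex.injective heq
  · obtain ⟨n, z, a, a', ha, -, h1⟩ := hμ.exists_splice_of_cdf_eq hlt h.symm
    exact absurd ⟨x, ⟨n, z, a, a', ha, Or.inr h1⟩, rfl⟩ hx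

theorem hasDerivWithinAt_intervalMap (hμ : IsChainLaw p ε μ) {ω : ℝ} (hω : ω ∈ Icc (0 : ℝ) 1)
    (hreg : ω ∉ cdf μ '' exceptional K) :
    HasDerivWithinAt (intervalMap μ) (1 / p (decode μ ω 0) (tail (decode μ ω))) (Icc 0 1) ω := by
  have hx := hμ.cdf_decode hω
  rw [hasDerivWithinAt_iff_tendsto_slope]
  have hcyl : ∀ n, ∀ᶠ u in 𝓝[Icc 0 1 \ {ω}] ω, decode μ u ∈ cylinder (decode μ ω) n := by
    intro n
    have h := hμ.eventually_forall_notMem (x := decode μ ω)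
      (isClopen_cylinder (decode μ ω) n).compl.isClosed fun y hy hc => hy ?_
    · rw [hx] at h
      filter_upwards [nhdsWithin_le_nhds h, self_mem_nhdsWithin] with u hu hu'
      exact not_not.1 (hu _ (hμ.cdf_decode hu'.1))
    · rw [← hμ.eq_of_cdf_eq (by rwa [hx]) hc.symm]
      exact fun _ _ => rfl
  have h := (hμ.tendsto_intervalMap_of_cylinder (x := decode μ ω) (l := 𝓝[Icc 0 1 \ {ω}] ω)
    (by rw [hx]; exact nhdsWithin_le_nhds)
    (by filter_upwards [self_mem_nhdsWithin] with u hu using hu.1)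
    (by rw [hx]; filter_upwards [self_mem_nhdsWithin] with u hu using hu.2) hcyl).2
  rw [hx] at h
  refine h.congr fun u => ?_
  rw [slope_def_field]
  rfl

end IsChainLaw

end InfChain

namespace InfChain

/-! ### Regularity under the matching condition -/

/-- An exponent `α ∈ ]0, 1]` with `ρ ≤ ε ^ α` for `ε, ρ ∈ ]0, 1[`; the value is `1` where the formula
`log ρ / log ε` does not give a positive number. -/
noncomputable def holderExponent (ε ρ : ℝ) : ℝ :=
  if 0 < Real.log ρ / Real.log ε then min 1 (Real.log ρ / Real.log ε) else 1

theorem holderExponent_pos (ε ρ : ℝ) : 0 < holderExponent ε ρ := by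
  unfold holderExponent
  split_ifs with h
  · exact lt_min one_pos h
  · exact one_pos

theorem holderExponent_le_one (ε ρ : ℝ) : holderExponent ε ρ ≤ 1 := by
  unfold holderExponent
  split_ifs with h
  · exact min_le_left _ _
  · exact le_rfl

theorem le_rpow_holderExponent {ε ρ : ℝ} (hε : 0 < ε) (hε1 : ε < 1) (hρ : 0 < ρ) (hρ1 : ρ < 1) :
    ρ ≤ ε ^ holderExponent ε ρ := by
  have h1 := Real.log_neg hε hε1
  have h2 := Real.log_neg hρ hρ1
  have h : holderExponent ε ρ ≤ Real.log ρ / Real.log ε := by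
    rw [holderExponent, if_pos (div_pos_of_neg_of_neg h2 h1)]
    exact min_le_right _ _
  rw [Real.le_rpow_iff_log_le hρ hε]
  rwa [le_div_iff_of_neg h1] at h

namespace IsChainLaw

variable {K : ℕ} {p : Fin K → (ℕ → Fin K) → ℝ} {ε : ℝ} {μ : Measure (ℕ → Fin K)}

/-- A variation of `p` of at most `C ρ ^ m` on cylinders of length `m` turns into a Hölder bound in
any distance `r` that is at least `ε ^ (m + 1)`, the lower bound for the measure of a cylinder of
length `m + 1`. -/
theorem abs_prob_sub_le_rpow (hμ : IsChainLaw p ε μ) {C ρ : ℝ} (hρ : 0 < ρ) (hρ1 : ρ < 1)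
    (hC : 0 ≤ C)
    (hp : ∀ (m : ℕ) (a : Fin K) (x y : ℕ → Fin K), (∀ i < m, x i = y i) →
      |p a x - p a y| ≤ C * ρ ^ m)
    {j : Fin K} {w x : ℕ → Fin K} {m : ℕ} {r : ℝ} (hm : 1 ≤ m) (hwx : ∀ i < m, w i = x i)
    (hr : ε ^ (m + 1) ≤ r) :
    |p j (tail w) - p j (tail x)| ≤ C * (ρ ^ 2)⁻¹ * r ^ holderExponent ε ρ := by
  obtain ⟨k, rfl⟩ : ∃ k, m = k + 1 := ⟨m - 1, by omega⟩
  refine (hp k j _ _ fun i hi => hwx (i + 1) (by omega)).trans ?_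
  rw [mul_assoc]
  refine mul_le_mul_of_nonneg_left ?_ hC
  rw [inv_mul_eq_div, le_div_iff₀ (by positivity), ← pow_add]
  calc ρ ^ (k + 1 + 1) ≤ (ε ^ holderExponent ε ρ) ^ (k + 1 + 1) :=
        pow_le_pow_left₀ hρ.le (le_rpow_holderExponent hμ.pos hμ.eps_lt_one hρ hρ1) _
    _ = (ε ^ (k + 1 + 1)) ^ holderExponent ε ρ := by
        rw [← Real.rpow_natCast, ← Real.rpow_natCast, ← Real.rpow_mul hμ.pos.le,
          ← Real.rpow_mul hμ.pos.le, mul_comm]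
    _ ≤ r ^ holderExponent ε ρ :=
        Real.rpow_le_rpow (pow_nonneg hμ.pos.le _) hr (holderExponent_pos _ _).le

variable [NeZero K]

/-- Under the matching condition the transition probability depends only on the coded point
(within an interval of the partition). -/
theorem prob_eq_of_matching (hμ : IsChainLaw p ε μ) (hm : Matching p) {x y : ℕ → Fin K}
    (h0 : x 0 = y 0) (h : cdf μ x = cdf μ y) : p (x 0) (tail x) = p (y 0) (tail y) := by
  wlog hlt : toLex x < toLex y generalizing x y
  · rcases (not_lt.1 hlt).eq_or_lt with heq | hlt'
    · rw [toLex.injective heq]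
    · exact (this h0.symm h.symm hlt').symm
  obtain ⟨n, z, a, a', ha, rfl, rfl⟩ := hμ.exists_splice_of_cdf_eq hlt h
  rcases Nat.eq_zero_or_pos n with rfl | hn
  · rw [splice_self, splice_self] at h0
    rw [h0] at ha; omega
  · rw [splice_of_lt hn, splice_of_lt hn]
    exact hm n hn z a a' ha

theorem exists_code_in_closedPiece (hμ : IsChainLaw p ε μ) (j : Fin K) {u : ℝ}
    (hu : u ∈ closedPiece (cutPt μ) j) : ∃ y, y 0 = j ∧ cdf μ y = u := by
  obtain ⟨y, rfl⟩ := hμ.exists_cdf_eq (hμ.closedPiece_subset j hu)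
  rw [closedPiece, hμ.cutPt_castSucc, cutPt_succ] at hu
  rcases lt_trichotomy (y 0) j with h | h | h
  · exact ⟨_, rfl, le_antisymm hu.1
      (hμ.cdf_mono (lex_lt_of_zero_lt (y := cons j fun _ => ⊥) h).le)⟩
  · exact ⟨y, h, rfl⟩
  · exact ⟨_, rfl, le_antisymm
      (hμ.cdf_mono (lex_lt_of_zero_lt (x := cons j fun _ => ⊤) h).le) hu.2⟩

/-- Under the matching condition each branch has a `C¹` extension to the closed interval, whose
derivative is the reciprocal of the transition probability. -/
theorem exists_extension_of_matching (hμ : IsChainLaw p ε μ) (hm : Matching p) (j : Fin K) :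
    ∃ g : ℝ → ℝ, EqOn (intervalMap μ) g (piece (cutPt μ) j) ∧
      ContDiffOn ℝ 1 g (closedPiece (cutPt μ) j) ∧
      ∀ y : ℕ → Fin K, y 0 = j →
        derivWithin g (closedPiece (cutPt μ) j) (cdf μ y) = 1 / p j (tail y) := by
  choose! f hf0 hf using fun u hu => hμ.exists_code_in_closedPiece j (u := u) hu
  set s := closedPiece (cutPt μ) j
  have hmem : ∀ y : ℕ → Fin K, y 0 = j → cdf μ y ∈ s := by
    rintro y rfl
    exact hμ.cdf_mem_closedPiece y
  -- the transition probability as a function of the coded point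
  set D : ℝ → ℝ := fun u => p j (tail (f u))
  have hD : ∀ y : ℕ → Fin K, y 0 = j → D (cdf μ y) = p j (tail y) := by
    intro y hy
    have h0 := hf0 _ (hmem y hy)
    have := hμ.prob_eq_of_matching hm (h0.trans hy.symm) (hf _ (hmem y hy))
    rwa [h0, hy] at this
  have hDpos : ∀ u, 0 < D u := fun u => hμ.prob_pos _ _
  -- the coding map restricted to a cylinder is closed, so continuity descends along it
  have hDcont : ContinuousOn D s := by
    refine continuousOn_iff_isClosed.2 fun F hF =>
      ⟨cdf μ '' ({y | y 0 = j} ∩ {y | p j (tail y) ∈ F}), ?_, ?_⟩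
    · refine IsCompact.isClosed (IsCompact.image (IsClosed.isCompact ?_) hμ.continuous_cdf)
      exact (isClosed_singleton.preimage (continuous_apply 0)).inter
        (hF.preimage ((hμ.continuous_prob j).comp continuous_tail))
    · ext u
      constructor
      · rintro ⟨h1, h2⟩
        exact ⟨⟨f u, ⟨hf0 u h2, h1⟩, hf u h2⟩, h2⟩
      · rintro ⟨⟨y, ⟨h0, h1⟩, rfl⟩, h2⟩
        refine ⟨?_, h2⟩
        change D (cdf μ y) ∈ F
        rw [hD y h0]; exact h1
  have hderiv : ∀ u ∈ s, HasDerivWithinAt (fun v => cdf μ (tail (f v))) (1 / D u) s u := by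
    intro u hu
    rw [hasDerivWithinAt_iff_tendsto_slope]
    have hev : ∀ᶠ v in 𝓝[s \ {u}] u, v ∈ s ∧ v ≠ u := self_mem_nhdsWithin
    have key := hμ.tendsto_slope_of_prob (l := 𝓝[s \ {u}] u) (f := f) (x := f u)
      (hDpos u).ne' ?_ ?_ ?_
    · refine key.congr' ?_
      filter_upwards [hev] with v hv
      rw [slope_def_field, hf v hv.1, hf u hu]
    · filter_upwards [hev] with v hv
      rw [hf v hv.1, hf u hu]; exact hv.2
    · filter_upwards [hev] with v hv
      rw [hf0 v hv.1, hf0 u hu]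
    · intro δ hδ
      obtain ⟨η, hη, hball⟩ := Metric.continuousOn_iff.1 hDcont u hu δ hδ
      filter_upwards [hev, nhdsWithin_le_nhds (Metric.ball_mem_nhds u hη)] with v hv hvη w hw
      rw [Metric.mem_ball, Real.dist_eq] at hvη
      have hc : |cdf μ (cons j w) - u| ≤ |v - u| := by
        have e1 : ∀ t ∈ s, cons j (tail (f t)) = f t := fun t ht => by
          conv_rhs => rw [← cons_tail (f t), hf0 t ht]
        rcases hw with hw | hw
        · have g1 := hμ.cdf_mono (cons_lex_le_cons (a := j).2 hw.1.le)
          have g2 := hμ.cdf_mono (cons_lex_le_cons (a := j).2 hw.2)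
          rw [e1 _ hu, hf u hu] at g1
          rw [e1 _ hv.1, hf v hv.1] at g2
          rw [abs_of_nonneg (by linarith), abs_of_nonneg (by linarith)]
          linarith
        · have g1 := hμ.cdf_mono (cons_lex_le_cons (a := j).2 hw.1.le)
          have g2 := hμ.cdf_mono (cons_lex_le_cons (a := j).2 hw.2)
          rw [e1 _ hu, hf u hu] at g2
          rw [e1 _ hv.1, hf v hv.1] at g1
          rw [abs_of_nonpos (by linarith), abs_of_nonpos (by linarith)]
          linarith
      have := hball (cdf μ (cons j w)) (hmem _ rfl) (by
        rw [Real.dist_eq]; exact hc.trans_lt hvη)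
      rw [Real.dist_eq, hD _ (cons_zero j w), tail_cons] at this
      rw [hf0 u hu]
      exact this.le
  have hud : UniqueDiffOn ℝ s := uniqueDiffOn_Icc (hμ.cutPt_lt j)
  refine ⟨fun v => cdf μ (tail (f v)), fun u hu => ?_, ?_, fun y hy => ?_⟩
  · have hus : u ∈ s := Ioo_subset_Icc_self hu
    rw [← hf u hus] at hu
    have := hμ.intervalMap_cdf hu
    rwa [hf u hus] at this
  · rw [contDiffOn_one_iff_derivWithin hud]
    refine ⟨fun u hu => (hderiv u hu).differentiableWithinAt, ?_⟩
    refine ContinuousOn.congr (hDcont.inv₀ fun u _ => (hDpos u).ne') fun u hu => ?_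
    rw [(hderiv u hu).derivWithin (hud u hu), one_div]
    rfl
  · rw [(hderiv _ (hmem y hy)).derivWithin (hud _ (hmem y hy)), hD y hy]

theorem isPiecewiseC1_intervalMap (hμ : IsChainLaw p ε μ) (hm : Matching p) :
    IsPiecewiseC1 (intervalMap μ) (cutPt μ) := fun j => by
  obtain ⟨g, h1, h2, -⟩ := hμ.exists_extension_of_matching hm j
  exact ⟨g, h1, h2⟩

/-- Hölder continuity of the transition probability as a function of the coded point. Two codes
are compared through the pair of codes of the point of `h(𝒬)` that separates them. -/
theorem abs_prob_sub_le_rpow_of_lt (hμ : IsChainLaw p ε μ) (hmat : Matching p) {C ρ : ℝ}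
    (hρ : 0 < ρ) (hρ1 : ρ < 1) (hC : 0 ≤ C)
    (hp : ∀ (m : ℕ) (a : Fin K) (x y : ℕ → Fin K), (∀ i < m, x i = y i) →
      |p a x - p a y| ≤ C * ρ ^ m)
    {j : Fin K} {x y : ℕ → Fin K} (hx0 : x 0 = j) (hy0 : y 0 = j) (hlt : toLex x < toLex y) :
    |p j (tail x) - p j (tail y)| ≤
      2 * (C * (ρ ^ 2)⁻¹) * (cdf μ y - cdf μ x) ^ holderExponent ε ρ := by
  obtain ⟨n, a', h1, h2, ha', hle1, hle2⟩ := exists_splice_between hlt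
  have hn : 1 ≤ n := by
    rcases Nat.eq_zero_or_pos n with rfl | hn
    · rw [hx0, hy0] at h2; exact absurd h2 (lt_irrefl _)
    · exact hn
  have hA : 0 ≤ C * (ρ ^ 2)⁻¹ := by positivity
  have hceq := hμ.cdf_splice_eq ha' n x
  have c1 := hμ.cdf_mono hle1
  have c3 := hμ.cdf_mono hle2
  have hmid : p j (tail (splice n x (x n) ⊤)) = p j (tail (splice n x a' ⊥)) := by
    have := hmat n hn x (x n) a' ha'
    rwa [hx0] at this
  have hleft : |p j (tail x) - p j (tail (splice n x (x n) ⊤))| ≤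
      C * (ρ ^ 2)⁻¹ * (cdf μ y - cdf μ x) ^ holderExponent ε ρ := by
    rcases hle1.eq_or_lt with h' | h'
    · rw [← toLex.injective h', sub_self, abs_zero]
      exact mul_nonneg hA (Real.rpow_nonneg (by linarith) _)
    · obtain ⟨m, hm, hag, hcyl⟩ := exists_cylinder_between_top (fun _ _ => rfl) h'
      refine hμ.abs_prob_sub_le_rpow hρ hρ1 hC hp (hn.trans hm) hag ?_
      have := hμ.pow_le_cdf_sub hcyl
      linarith
  have hright : |p j (tail y) - p j (tail (splice n x a' ⊥))| ≤
      C * (ρ ^ 2)⁻¹ * (cdf μ y - cdf μ x) ^ holderExponent ε ρ := by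
    rcases hle2.eq_or_lt with h' | h'
    · rw [toLex.injective h', sub_self, abs_zero]
      exact mul_nonneg hA (Real.rpow_nonneg (by linarith) _)
    · obtain ⟨m, hm, hag, hcyl⟩ := exists_cylinder_between_bot (fun i hi => (h1 i hi).symm) h'
      refine hμ.abs_prob_sub_le_rpow hρ hρ1 hC hp (hn.trans hm) hag ?_
      have := hμ.pow_le_cdf_sub' hcyl
      linarith
  rw [← hmid, abs_sub_comm] at hright
  have := abs_sub_le (p j (tail x)) (p j (tail (splice n x (x n) ⊤))) (p j (tail y))
  linarith

theorem isPiecewiseC1Holder_intervalMap (hμ : IsChainLaw p ε μ) (hmat : Matching p) {C ρ : ℝ}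
    (hρ : 0 < ρ) (hρ1 : ρ < 1) (hC : 0 ≤ C)
    (hp : ∀ (m : ℕ) (a : Fin K) (x y : ℕ → Fin K), (∀ i < m, x i = y i) →
      |p a x - p a y| ≤ C * ρ ^ m) :
    IsPiecewiseC1Holder (intervalMap μ) (cutPt μ) (holderExponent ε ρ) := by
  intro j
  obtain ⟨g, hg1, hg2, hg3⟩ := hμ.exists_extension_of_matching hmat j
  refine ⟨g, hg1, hg2, (ε ^ 2)⁻¹ * (2 * (C * (ρ ^ 2)⁻¹)), fun u hu v hv => ?_⟩
  obtain ⟨x, hx0, rfl⟩ := hμ.exists_code_in_closedPiece j hu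
  obtain ⟨y, hy0, rfl⟩ := hμ.exists_code_in_closedPiece j hv
  have hA : 0 ≤ 2 * (C * (ρ ^ 2)⁻¹) := by positivity
  have hprob : |p j (tail x) - p j (tail y)| ≤
      2 * (C * (ρ ^ 2)⁻¹) * |cdf μ x - cdf μ y| ^ holderExponent ε ρ := by
    rcases lt_trichotomy (toLex x) (toLex y) with h | h | h
    · rw [abs_sub_comm (cdf μ x), abs_of_nonneg (sub_nonneg.2 (hμ.cdf_mono h.le))]
      exact hμ.abs_prob_sub_le_rpow_of_lt hmat hρ hρ1 hC hp hx0 hy0 h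
    · rw [toLex.injective h, sub_self, abs_zero]
      exact mul_nonneg hA (Real.rpow_nonneg (abs_nonneg _) _)
    · rw [abs_sub_comm (p j _), abs_of_nonneg (sub_nonneg.2 (hμ.cdf_mono h.le))]
      exact hμ.abs_prob_sub_le_rpow_of_lt hmat hρ hρ1 hC hp hy0 hx0 h
  rw [hg3 x hx0, hg3 y hy0, mul_assoc]
  have px := hμ.prob_pos j (tail x)
  have py := hμ.prob_pos j (tail y)
  have hdiv : 1 / p j (tail x) - 1 / p j (tail y) =
      (p j (tail x) * p j (tail y))⁻¹ * (p j (tail y) - p j (tail x)) := by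
    field_simp
  rw [hdiv, abs_mul, abs_of_pos (by positivity), abs_sub_comm]
  refine mul_le_mul ?_ hprob (abs_nonneg _) (inv_nonneg.2 (sq_nonneg _))
  refine inv_anti₀ (pow_pos hμ.pos 2) ?_
  rw [sq]
  exact mul_le_mul (hμ.le _ _) (hμ.le _ _) hμ.pos.le px.le

end IsChainLaw

end InfChain

namespace InfChain

/-! ### The one-sided law of an invariant measure -/

section Law

variable {K : ℕ}

theorem measurable_upToZero : Measurable (upToZero : (ℤ → Fin K) → ℕ → Fin K) :=
  measurable_pi_lambda _ fun _ => measurable_pi_apply _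

theorem upToZero_shift (z : ℤ → Fin K) : upToZero (shift z) = tail (upToZero z) := by
  funext n
  simp only [upToZero, shift, tail]
  congr 1
  push_cast
  ring

theorem pastOf_eq_upToZero_shift (z : ℤ → Fin K) : pastOf z = upToZero (shift z) := by
  funext n
  simp only [upToZero, shift, pastOf]
  congr 1
  ring

/-- The law of `z_{-∞}^0`. -/
noncomputable def oneSidedLaw (P : Measure (ℤ → Fin K)) : Measure (ℕ → Fin K) := P.map upToZero

theorem measurePreserving_upToZero (P : Measure (ℤ → Fin K)) :
    MeasurePreserving upToZero P (oneSidedLaw P) := ⟨measurable_upToZero, rfl⟩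

theorem ergodic_tail {P : Measure (ℤ → Fin K)} (hP : Ergodic shift P) :
    Ergodic tail (oneSidedLaw P) :=
  (measurePreserving_upToZero P).ergodic_of_ergodic_semiconj hP measurable_tail upToZero_shift

variable {p : Fin K → (ℕ → Fin K) → ℝ}

theorem infProb_le (hp : IsTransitionFamily p) (a : Fin K) (y : ℕ → Fin K) :
    infProb p ≤ p a y := by
  refine csInf_le ⟨0, ?_⟩ ⟨a, y, rfl⟩
  rintro _ ⟨b, w, rfl⟩
  exact (hp.mem_Icc b w).1

theorem abs_prob_sub_le_one (hp : IsTransitionFamily p) (a : Fin K) (x y : ℕ → Fin K) :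
    |p a x - p a y| ≤ 1 := by
  obtain ⟨h1, h2⟩ := hp.mem_Icc a x
  obtain ⟨h3, h4⟩ := hp.mem_Icc a y
  exact abs_le.2 ⟨by linarith, by linarith⟩

theorem abs_prob_sub_le_contRate (hp : IsTransitionFamily p) {k : ℕ} (a : Fin K)
    {x y : ℕ → Fin K} (h : ∀ i < k, x i = y i) : |p a x - p a y| ≤ contRate p k := by
  refine le_csSup ⟨1, ?_⟩ ⟨a, x, y, h, rfl⟩
  rintro _ ⟨b, v, w, -, rfl⟩
  exact abs_prob_sub_le_one hp b v w

/-- The invariance relation, given for continuous test functions, extends to indicators. -/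
theorem measureReal_zero_tail_eq_setIntegral (hp : IsTransitionFamily p)
    {P : Measure (ℤ → Fin K)} [IsProbabilityMeasure P] (hP : MeasurePreserving shift P P)
    (hinv : IsInvariantFor P p) (a : Fin K) {B : Set (ℕ → Fin K)} (hB : MeasurableSet B) :
    (oneSidedLaw P).real {x | x 0 = a ∧ tail x ∈ B} = ∫ y in B, p a y ∂(oneSidedLaw P) := by
  set μ := oneSidedLaw P
  have hup : MeasurePreserving upToZero P μ := measurePreserving_upToZero P
  have : IsProbabilityMeasure μ := Measure.isProbabilityMeasure_map measurable_upToZero.aemeasurable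
  have hS : IsClopen {x : ℕ → Fin K | x 0 = a} :=
    (isClopen_discrete {a}).preimage (continuous_apply 0)
  have hint : Integrable (p a) μ := by
    refine Integrable.of_bound (hp.measurable a).aestronglyMeasurable 1 (ae_of_all _ fun y => ?_)
    rw [Real.norm_eq_abs, abs_of_nonneg (hp.mem_Icc a y).1]
    exact (hp.mem_Icc a y).2
  have hmp : Measurable fun y => ENNReal.ofReal (p a y) := (hp.measurable a).ennreal_ofReal
  have hfin : IsFiniteMeasure (μ.withDensity fun y => ENNReal.ofReal (p a y)) :=
    isFiniteMeasure_withDensity_ofReal hint.2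
  have key : (μ.restrict {x | x 0 = a}).map tail =
      μ.withDensity fun y => ENNReal.ofReal (p a y) := by
    refine ext_of_forall_integral_eq_of_IsFiniteMeasure fun f => ?_
    classical
    have hF : Continuous ({x : ℕ → Fin K | x 0 = a}.indicator fun x => f (tail x)) :=
      (f.continuous.comp continuous_tail).indicator fun x hx => by
        rw [hS.frontier_eq] at hx
        exact absurd hx (notMem_empty _)
    have hsum : ∀ y : ℕ → Fin K, ∑ b, p b y *
        {x : ℕ → Fin K | x 0 = a}.indicator (fun x => f (tail x)) (cons b y) = p a y * f y := by
      intro y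
      rw [Finset.sum_eq_single a]
      · rw [indicator_of_mem (s := {x : ℕ → Fin K | x 0 = a}) (cons_zero a y), tail_cons]
      · intro b _ hb
        rw [indicator_of_notMem (s := {x : ℕ → Fin K | x 0 = a}) (fun h => hb h), mul_zero]
      · exact fun h => absurd (Finset.mem_univ a) h
    rw [integral_map measurable_tail.aemeasurable f.continuous.aestronglyMeasurable,
      ← integral_indicator hS.isOpen.measurableSet,
      integral_withDensity_eq_integral_toReal_smul hmp (ae_of_all _ fun _ => ENNReal.ofReal_lt_top),
      ← hup.map_eq, integral_map measurable_upToZero.aemeasurable hF.aestronglyMeasurable,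
      hinv _ hF]
    simp only [hsum, pastOf_eq_upToZero_shift, ENNReal.toReal_ofReal (hp.mem_Icc a _).1,
      smul_eq_mul]
    have hmeas : Measurable fun y => p a y * f y := (hp.measurable a).mul f.continuous.measurable
    conv_rhs => rw [← hP.map_eq]
    rw [integral_map measurable_upToZero.aemeasurable hmeas.aestronglyMeasurable]
    exact (integral_map hP.aemeasurable
      (hmeas.comp measurable_upToZero).aestronglyMeasurable).symm
  have h1 : μ {x | x 0 = a ∧ tail x ∈ B} = ∫⁻ y in B, ENNReal.ofReal (p a y) ∂μ := by
    rw [← withDensity_apply _ hB, ← key, Measure.map_apply measurable_tail hB,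
      Measure.restrict_apply (measurable_tail hB), inter_comm]
    rfl
  rw [measureReal_def, h1, integral_eq_lintegral_of_nonneg_ae
    (ae_of_all _ fun y => (hp.mem_Icc a y).1) (hp.measurable a).aestronglyMeasurable]

theorem isChainLaw_oneSidedLaw (hK : 2 ≤ K) (hp : IsTransitionFamily p) (hnn : IsNonNull p)
    (hc : IsContinuousFamily p) {P : Measure (ℤ → Fin K)} [IsProbabilityMeasure P]
    (hP : MeasurePreserving shift P P) (hinv : IsInvariantFor P p) :
    IsChainLaw p (infProb p) (oneSidedLaw P) where
  two_le := hK
  isProb := Measure.isProbabilityMeasure_map measurable_upToZero.aemeasurable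
  measurable := hp.measurable
  pos := hnn
  le := infProb_le hp
  le_one_sub a y := by
    have : Nontrivial (Fin K) := Fin.nontrivial_iff_two_le.2 hK
    obtain ⟨b, hb⟩ := exists_ne a
    have h1 : ∑ c ∈ {a, b}, p c y ≤ ∑ c, p c y :=
      Finset.sum_le_univ_sum_of_nonneg fun c => (hp.mem_Icc c y).1
    rw [Finset.sum_pair hb.symm, hp.sum_eq_one] at h1
    linarith [infProb_le hp b y]
  unif δ hδ := by
    obtain ⟨n, hn⟩ := (hc.eventually (gt_mem_nhds hδ)).exists
    exact ⟨n, fun a x y h => (abs_prob_sub_le_contRate hp a h).trans hn.le⟩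
  step a _ hB := measureReal_zero_tail_eq_setIntegral hp hP hinv a hB

theorem hMap_eq_cdf (P : Measure (ℤ → Fin K)) : hMap P = cdf (oneSidedLaw P) := by
  funext x
  rw [cdf, oneSidedLaw, map_measureReal_apply measurable_upToZero
    (isClosed_lex_le x).measurableSet, hMap]
  rfl

end Law

end InfChain

theorem mainTheorem1 (K : ℕ) [NeZero K] (hK : 2 ≤ K) :
    -- the Hölder exponent, a function of the infimum of `p` and of the rate of decay of `β_k`
    ∃ α : ℝ → ℝ → ℝ, (∀ ε ρ, 0 < α ε ρ ∧ α ε ρ ≤ 1) ∧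
    ∀ (p : Fin K → (ℕ → Fin K) → ℝ), IsTransitionFamily p → IsNonNull p → IsContinuousFamily p →
    ∀ (P : Measure (ℤ → Fin K)), IsProbabilityMeasure P → Ergodic shift P → IsInvariantFor P p →
    -- `h⁻¹` is well defined on `Ω \ h(𝒬)`
    (∀ ω ∈ regularPoints P, ∃! x, hMap P x = ω) ∧
    -- (1) the end points
    endPt P (Fin.last K) = 1 ∧ StrictMono (endPt P) ∧
    (∀ a a' : Fin K, (a' : ℕ) = a + 1 → endPt P a.succ = hMap P (cons a' (fun _ => ⊥))) ∧
    ∃ T : ℝ → ℝ,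
      -- (1) `T` extends `h ∘ shift ∘ h⁻¹`
      EqOn T (baseMap P) (regularPoints P) ∧ MapsTo T (Icc 0 1) (Icc 0 1) ∧
      (∀ j, ContinuousOn T (piece (endPt P) j) ∧ StrictMonoOn T (piece (endPt P) j)) ∧
      -- (2) Markov property, invariance and ergodicity, conditional probabilities
      IsTopologicalMarkov T (endPt P) ∧
      Ergodic T (volume.restrict (Icc (0 : ℝ) 1)) ∧
      (∀ x : ℕ → Fin K,
        Tendsto (fun k => volume.real (dynCylinder T (endPt P) x (k + 1)) /
            volume.real (dynCylinder T (endPt P) (tail x) k))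
          atTop (𝓝 (p (x 0) (tail x)))) ∧
      (∀ a : Fin K,
        (volume.restrict (Icc (0 : ℝ) 1))[(piece (endPt P) a).indicator (fun _ => (1 : ℝ)) |
            MeasurableSpace.comap (fun ω => tail (code T (endPt P) ω)) inferInstance]
          =ᵐ[volume.restrict (Icc (0 : ℝ) 1)] fun ω => p a (tail (code T (endPt P) ω))) ∧
      -- (3) the derivative outside `h(𝒬)`
      (∀ ω ∈ regularPoints P,
        HasDerivWithinAt T (1 / p (hInv P ω 0) (tail (hInv P ω))) (Icc 0 1) ω) ∧
      -- (4) the one-sided derivatives on `h(𝒬)`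
      (∀ (n : ℕ) (z : ℕ → Fin K) (a a' : Fin K), (a' : ℕ) = a + 1 →
        hMap P (splice n z a ⊤) = hMap P (splice n z a' ⊥) ∧
        HasLeftDeriv T (1 / p (splice n z a ⊤ 0) (tail (splice n z a ⊤)))
          (hMap P (splice n z a ⊤)) ∧
        HasRightDeriv T (1 / p (splice n z a' ⊥ 0) (tail (splice n z a' ⊥)))
          (hMap P (splice n z a ⊤))) ∧
      -- (5) regularity under the matching condition
      (Matching p → IsPiecewiseC1 T (endPt P)) ∧
      -- (6) regularity under the matching condition and exponential decay
      (Matching p → ∀ ρ : ℝ, 0 < ρ → ρ < 1 → (∃ C : ℝ, ∀ k, 1 ≤ k → contRate p k ≤ C * ρ ^ k) →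
        IsPiecewiseC1Holder T (endPt P) (α (infProb p) ρ)) := by
  refine ⟨holderExponent, fun ε ρ => ⟨holderExponent_pos ε ρ, holderExponent_le_one ε ρ⟩, ?_⟩
  intro p hp hnn hc P hPprob hP hinv
  have hμ := isChainLaw_oneSidedLaw hK hp hnn hc hP.toMeasurePreserving hinv
  have ht := ergodic_tail hP
  have hh := hMap_eq_cdf P
  have hη : endPt P = cutPt (oneSidedLaw P) := by simp only [endPt, cutPt, hh]
  have hd : hInv P = decode (oneSidedLaw P) := by simp only [hInv, decode, hh]
  have hT : baseMap P = intervalMap (oneSidedLaw P) := by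
    funext ω
    simp only [baseMap, intervalMap, hh, hd]
  simp only [regularPoints, hη, hd, hT, hh]
  refine ⟨fun ω hω => ?_, hμ.cutPt_last, hμ.strictMono_cutPt,
    fun a a' ha => hμ.cdf_cons_top_eq ha, intervalMap (oneSidedLaw P), fun _ _ => rfl,
    fun u _ => hμ.intervalMap_mem_Icc u,
    fun j => ⟨hμ.continuousOn_intervalMap j, hμ.strictMonoOn_intervalMap j⟩,
    hμ.isTopologicalMarkov, hμ.ergodic_intervalMap ht,
    hμ.tendsto_volume_dynCylinder_div ht.toMeasurePreserving,
    hμ.condExp_indicator_piece ht.toMeasurePreserving,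
    fun ω hω => hμ.hasDerivWithinAt_intervalMap hω.1 hω.2,
    fun n z a a' ha => ⟨hμ.cdf_splice_eq ha n z, hμ.hasLeftDeriv_intervalMap ha n z,
      hμ.hasRightDeriv_intervalMap ha n z⟩,
    hμ.isPiecewiseC1_intervalMap, ?_⟩
  · obtain ⟨x, rfl⟩ := hμ.exists_cdf_eq hω.1
    exact ⟨x, rfl, fun y hy => (hμ.eq_of_cdf_eq hω.2 hy.symm).symm⟩
  · rintro hm ρ hρ hρ1 ⟨C, hC⟩
    -- the bound on the rates starts at `k = 1`; the maximum with `1` covers `k = 0`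
    refine hμ.isPiecewiseC1Holder_intervalMap hm hρ hρ1
      (zero_le_one.trans (le_max_right C 1)) fun m a x y hxy => ?_
    rcases Nat.eq_zero_or_pos m with rfl | hm0
    · rw [pow_zero, mul_one]
      exact (abs_prob_sub_le_one hp a x y).trans (le_max_right C 1)
    · exact (abs_prob_sub_le_contRate hp a hxy).trans ((hC m hm0).trans
        (mul_le_mul_of_nonneg_right (le_max_left C 1) (pow_nonneg hρ.le m)))
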